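/- For finite simple graphs $H$ and $G$ let $\mathrm{hom}(H,G)$ be the number of graph homomorphisms from $H$ to $G$, $\mathrm{sub}(H,G)$ the number of subgraphs of $G$ isomorphic to $H$, and $\mathrm{ind}(H,G)$ the number of induced subgraphs of $G$ isomorphic to $H$. A graph is $d$-degenerate if every non-empty subgraph of it contains a vertex of degree at most $d$. A $d$-degenerate host $G$ with vertices $0,\dots,n-1$ is given to the machine, in read-only form, by its adjacency lists along a $d$-degeneracy ordering, i.e. for each vertex the list (in any order) of the at most $d$ neighbours that come later in some fixed linear order of the vertices; such an ordering exists for every $d$-degenerate graph. The machine is a unit-cost RAM with addition, truncated subtraction, multiplication, integer division, comparison, direct and indirect addressing, and instructions that read $n$, the length of a list, and an entry of a list. **Theorem.** There are functions $f,s:\mathbb N\times\mathbb N\to\mathbb N$ such that for every $k\ge 0$ and every $k$-vertex pattern graph $H$ there are three RAM programs, depending only on $H$, which for all $d\ge 0$, $n\ge 1$ and every $n$-vertex $d$-degenerate graph $G$, given as above, compute $\mathrm{hom}(H,G)$, $\mathrm{sub}(H,G)$ and $\mathrm{ind}(H,G)$ respectively, each in at most $$f(k,d)\cdot n^{\lfloor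 k/4\rfloor+2}$$ steps and using constant space: at most $s(k,d)$ memory cells, each of which holds throughout the computation a non-negative integer of at most $s(k,d)\cdot n^{s(k,d)}$, that is, $O(\log n)$ bits for fixed $k$ and $d$. -/

import Mathlib

namespace HostCount

/-! ### Counting patterns in a host graph -/

/-- `hom(H, G)`: the number of graph homomorphisms from `H` to `G`. -/
noncomputable def hom {k n : ℕ} (H : SimpleGraph (Fin k)) (G : SimpleGraph (Fin n)) : ℕ :=
  Nat.card (H →g G)

/-- `sub(H, G)`: the number of subgraphs of `G` that are isomorphic to `H`. -/
noncomputable def sub {k n : ℕ} (H : SimpleGraph (Fin k)) (G : SimpleGraph (Fin n)) : ℕ :=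
  G.copyCount H

/-- `ind(H, G)`: the number of induced subgraphs of `G` that are isomorphic to `H`, counted by
their vertex sets. -/
noncomputable def ind {k n : ℕ} (H : SimpleGraph (Fin k)) (G : SimpleGraph (Fin n)) : ℕ :=
  Nat.card {S : Set (Fin n) // Nonempty (H ≃g G.induce S)}

/-! ### Degenerate graphs and how they are given to the machine -/

/-- `G` is `d`-degenerate: every (non-empty) subgraph has a vertex of degree at most `d`. -/
def IsDegenerate {n : ℕ} (G : SimpleGraph (Fin n)) (d : ℕ) : Prop :=
  ∀ G' : G.Subgraph, G'.verts.Nonempty → ∃ v ∈ G'.verts, (G'.neighborSet v).ncard ≤ d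

/-- An adjacency-list presentation of `G` along a `d`-degeneracy ordering: for every vertex, a list
(in any order) of its neighbours that come later in the ordering, at most `d` of them. -/
structure Presentation {n : ℕ} (G : SimpleGraph (Fin n)) (d : ℕ) where
  /-- the position of a vertex in the ordering -/
  rank : Fin n → ℕ
  rank_injective : Function.Injective rank
  /-- the list of later neighbours of a vertex -/
  out : Fin n → List (Fin n)
  nodup_out : ∀ v, (out v).Nodup
  mem_out : ∀ v w, w ∈ out v ↔ G.Adj v w ∧ rank v < rank w
  length_out_le : ∀ v, (out v).length ≤ d

/-- Every `d`-degenerate graph has such a presentation. -/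
theorem IsDegenerate.nonempty_presentation {n d : ℕ} {G : SimpleGraph (Fin n)}
    (hG : IsDegenerate G d) : Nonempty (Presentation G d) := by
  classical
  have key : ∀ m : ℕ, ∀ S : Finset (Fin n), S.card = m → ∃ r : Fin n → ℕ, Set.InjOn r S ∧
      ∀ v ∈ S, (S.filter (fun w => G.Adj v w ∧ r v < r w)).card ≤ d := by
    intro m
    induction m with
    | zero =>
      intro S hS
      rw [Finset.card_eq_zero] at hS
      subst hS
      exact ⟨fun _ => 0, by simp, by simp⟩
    | succ m ih =>
      intro S hS
      have hne : S.Nonempty := Finset.card_pos.mp (by omega)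
      obtain ⟨v₀, hv₀, hdeg⟩ := hG ((⊤ : G.Subgraph).induce (S : Set (Fin n)))
        (by simpa using hne)
      have hv₀' : v₀ ∈ S := by simpa using hv₀
      obtain ⟨r, hr, hrd⟩ := ih (S.erase v₀) (by rw [Finset.card_erase_of_mem hv₀']; omega)
      refine ⟨fun v => if v = v₀ then 0 else r v + 1, ?_, ?_⟩
      · intro a ha b hb hab
        by_cases h1 : a = v₀ <;> by_cases h2 : b = v₀ <;> simp [h1, h2] at hab ⊢
        exact hr (by simpa [h1] using ha) (by simpa [h2] using hb) hab
      · intro v hv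
        by_cases h1 : v = v₀
        · subst h1
          refine le_trans ?_ hdeg
          rw [← Set.ncard_coe_finset]
          apply Set.ncard_le_ncard _ (Set.toFinite _)
          intro w hw
          simp only [Finset.coe_filter, Set.mem_ofPred_eq] at hw
          simp [hw.1, hw.2.1, hv₀']
        · refine le_trans (Finset.card_le_card ?_) (hrd v (by simp [h1, hv]))
          intro w hw
          simp only [Finset.mem_filter, if_neg h1] at hw
          by_cases h2 : w = v₀
          · simp [h2] at hw
          · simp only [if_neg h2] at hw
            simp only [Finset.mem_filter, Finset.mem_erase]
            exact ⟨⟨h2, hw.1⟩, hw.2.1, by omega⟩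
  obtain ⟨r, hr, hrd⟩ := key _ Finset.univ rfl
  refine ⟨⟨r, fun a b h => hr (by simp) (by simp) h,
    fun v => (Finset.univ.filter (fun w => G.Adj v w ∧ r v < r w)).toList,
    fun v => Finset.nodup_toList _, fun v w => by simp, fun v => ?_⟩⟩
  simpa using hrd v (by simp)

/-! ### The unit-cost RAM -/

/-- Instructions of a random access machine. Operands are addresses of memory cells, except for
the literal `c` and the jump targets. The last three read the (read-only) input. -/
inductive Instr where
  /-- `M[dst] := c` -/
  | const (dst c : ℕ)
  /-- `M[dst] := M[a] + M[b]` -/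
  | add (dst a b : ℕ)
  /-- `M[dst] := max (M[a] - M[b]) 0` -/
  | sub (dst a b : ℕ)
  /-- `M[dst] := M[a] * M[b]` -/
  | mul (dst a b : ℕ)
  /-- `M[dst] := ⌊M[a] / M[b]⌋` -/
  | div (dst a b : ℕ)
  /-- `M[dst] := M[M[a]]` -/
  | load (dst a : ℕ)
  /-- `M[M[a]] := M[src]` -/
  | store (a src : ℕ)
  /-- if `M[a] < M[b]` then go to the instruction number `target` -/
  | jumpLt (a b target : ℕ)
  /-- `M[dst] :=` the number of vertices of the host -/
  | vertexCount (dst : ℕ)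
  /-- `M[dst] :=` the length of the list of the vertex `M[v]` (`0` if there is no such vertex) -/
  | outDegree (dst v : ℕ)
  /-- `M[dst] :=` the entry number `M[i]`, counted from `0`, of the list of the vertex `M[v]`
  (`0` if there is no such vertex or no such entry) -/
  | outNeighbor (dst v i : ℕ)

/-- A program is a finite list of instructions. -/
abbrev Program := List Instr

/-- A configuration: the number of the next instruction and the contents of the memory. -/
structure Config where
  pc : ℕ
  mem : ℕ → ℕ

/-- At the start all memory cells hold `0`. -/
def Config.init : Config := ⟨0, fun _ => 0⟩

/-- Write `x` to the cell `a` and go on to the next instruction. -/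
def Config.write (c : Config) (a x : ℕ) : Config := ⟨c.pc + 1, Function.update c.mem a x⟩

/-- The effect of one instruction, where the input is the family of lists `out`. -/
def Instr.exec {n : ℕ} (out : Fin n → List (Fin n)) (c : Config) : Instr → Config
  | .const dst x => c.write dst x
  | .add dst a b => c.write dst (c.mem a + c.mem b)
  | .sub dst a b => c.write dst (c.mem a - c.mem b)
  | .mul dst a b => c.write dst (c.mem a * c.mem b)
  | .div dst a b => c.write dst (c.mem a / c.mem b)
  | .load dst a => c.write dst (c.mem (c.mem a))
  | .store a src => c.write (c.mem a) (c.mem src)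
  | .jumpLt a b target => if c.mem a < c.mem b then ⟨target, c.mem⟩ else ⟨c.pc + 1, c.mem⟩
  | .vertexCount dst => c.write dst n
  | .outDegree dst v =>
      c.write dst (if h : c.mem v < n then (out ⟨c.mem v, h⟩).length else 0)
  | .outNeighbor dst v i =>
      c.write dst (if h : c.mem v < n then
        ((out ⟨c.mem v, h⟩)[c.mem i]?).elim 0 (fun w => (w : ℕ)) else 0)

/-- The machine halts when it leaves the program. -/
def Config.Halted (P : Program) (c : Config) : Prop := P.length ≤ c.pc

/-- One step of the machine; a halted machine stays as it is. -/
def step {n : ℕ} (P : Program) (out : Fin n → List (Fin n)) (c : Config) : Config :=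
  match P[c.pc]? with
  | some i => i.exec out c
  | none => c

/-- The configuration after `t` steps. -/
def run {n : ℕ} (P : Program) (out : Fin n → List (Fin n)) (t : ℕ) : Config :=
  (step P out)^[t] Config.init

/-- On the input `out` the program `P` halts within `time` steps with `result` in the cell `0`, and
throughout the computation it uses only the cells with addresses below `space` (all others keep
their initial value `0`) and no cell ever holds a number larger than `word`. -/
def ComputesWithin {n : ℕ} (P : Program) (out : Fin n → List (Fin n))
    (result time space word : ℕ) : Prop :=
  ∃ t ≤ time, (run P out t).Halted P ∧ (run P out t).mem 0 = result ∧
    ∀ j ≤ t, ∀ a, (run P out j).mem a ≤ word ∧ (space ≤ a → (run P out j).mem a = 0)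

end HostCount

/-! Every host edge points from earlier to later in the given ordering, so the host becomes a
digraph with out-lists of length at most `d`. Once the image of a pattern vertex is fixed, the image
of an out-neighbour ranges over at most `d` values. Only guesses of images among all `n` vertices
cost a factor `n`, and the exponent is the nesting depth of such guesses.

Reduction to digraphs. Counts of maps under adjacency, non-adjacency and distinctness conditions are
sums and differences of counts of maps that respect the arcs of a digraph `D` on at most `k`
vertices. An adjacency splits into its two orientations, a non-adjacency is a difference, and an
inequality is a difference with the pattern in which the two vertices are identified. Division by
the number of automorphisms of `H` turns injective maps into subgraphs and embeddings into induced
subgraphs.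

Counting for a digraph (`evaluable_univ`). Choose an irredundant set `S` of sources reaching
everything. Guessing the image of a source leaves boundedly many choices for all that it reaches.
Parts without arcs between them are counted separately and multiplied, so their depths do not add.
The potential counts the remaining vertices outside `S` and the sources that still reach at least
two of them; it is at most `k` at the start. A guess that lowers it by 4 exists if a source reaches
three such vertices, or if two sources reach exactly two each and share one. Otherwise the rest
splits into parts of depth 2 (`evaluable_of_disjoint`). Hence the depth is at most `⌊k/4⌋ + 2`.

Machine. The counts are written as arithmetic expressions with sums over all vertices or over one
list, and `Expr.compile` turns these into nested loops. The number of registers depends only on the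
expression, and all values are polynomial in `n + d`. -/

namespace HostCount

/-! ### Executions of the machine with bounded memory -/

/-- All cells hold numbers up to `W`, and the cells from `S` on hold `0`. -/
def Bounded (W S : ℕ) (m : ℕ → ℕ) : Prop := ∀ a, m a ≤ W ∧ (S ≤ a → m a = 0)

/-- The program `P` leads from `c` to `c'` in at most `T` steps, with bounded memory throughout. -/
def Leads {n : ℕ} (P : Program) (out : Fin n → List (Fin n)) (W S T : ℕ) (c c' : Config) : Prop :=
  ∃ t ≤ T, (step P out)^[t] c = c' ∧ ∀ j ≤ t, Bounded W S ((step P out)^[j] c).mem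

section Leads

variable {n : ℕ} {P : Program} {out : Fin n → List (Fin n)} {W S : ℕ}

theorem Bounded.update {m : ℕ → ℕ} (h : Bounded W S m) {a x : ℕ} (ha : a < S) (hx : x ≤ W) :
    Bounded W S (Function.update m a x) := by
  intro b
  by_cases hb : b = a
  · subst hb; simp [hx]; omega
  · simpa [Function.update_of_ne hb] using h b

theorem Leads.refl {c : Config} (h : Bounded W S c.mem) (T : ℕ) : Leads P out W S T c c :=
  ⟨0, Nat.zero_le _, rfl, fun j hj => by obtain rfl := Nat.le_zero.mp hj; exact h⟩

theorem Leads.trans {T₁ T₂ : ℕ} {c₁ c₂ c₃ : Config} (h₁ : Leads P out W S T₁ c₁ c₂)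
    (h₂ : Leads P out W S T₂ c₂ c₃) : Leads P out W S (T₁ + T₂) c₁ c₃ := by
  obtain ⟨t₁, ht₁, e₁, g₁⟩ := h₁
  obtain ⟨t₂, ht₂, e₂, g₂⟩ := h₂
  refine ⟨t₂ + t₁, by omega, by rw [Function.iterate_add_apply, e₁, e₂], fun j hj => ?_⟩
  by_cases hj₁ : j ≤ t₁
  · exact g₁ j hj₁
  · obtain ⟨i, rfl⟩ : ∃ i, j = i + t₁ := ⟨j - t₁, by omega⟩
    rw [Function.iterate_add_apply, e₁]
    exact g₂ i (by omega)

theorem Leads.mono {T T' : ℕ} {c c' : Config} (h : Leads P out W S T c c') (hT : T ≤ T') :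
    Leads P out W S T' c c' := by
  obtain ⟨t, ht, e, g⟩ := h
  exact ⟨t, ht.trans hT, e, g⟩

theorem Leads.bounded {T : ℕ} {c c' : Config} (h : Leads P out W S T c c') :
    Bounded W S c'.mem := by
  obtain ⟨t, -, rfl, g⟩ := h
  exact g t le_rfl

theorem Leads.single {c c' : Config} {i : Instr} (hi : P[c.pc]? = some i)
    (hc : Bounded W S c.mem) (he : i.exec out c = c') (hc' : Bounded W S c'.mem) :
    Leads P out W S 1 c c' := by
  have hs : step P out c = c' := by simp [step, hi, he]
  refine ⟨1, le_rfl, hs, fun j hj => ?_⟩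
  interval_cases j
  · exact hc
  · simpa [hs] using hc'

theorem Leads.write {p : ℕ} {m : ℕ → ℕ} {a x : ℕ} {i : Instr} (hi : P[p]? = some i)
    (hm : Bounded W S m) (he : i.exec out ⟨p, m⟩ = Config.write ⟨p, m⟩ a x) (ha : a < S)
    (hx : x ≤ W) : Leads P out W S 1 ⟨p, m⟩ ⟨p + 1, Function.update m a x⟩ :=
  Leads.single hi hm he (hm.update ha hx)

end Leads

/-! ### Arithmetic expressions with sums over vertices and over lists of out-neighbours -/

/-- The arithmetic operations of the machine. -/
inductive BinOp where
  | add | sub | mul | div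

/-- The value of an arithmetic operation. -/
def BinOp.eval : BinOp → ℕ → ℕ → ℕ
  | .add, x, y => x + y
  | .sub, x, y => x - y
  | .mul, x, y => x * y
  | .div, x, y => x / y

/-- The instruction that performs an arithmetic operation. -/
def BinOp.instr : BinOp → ℕ → ℕ → ℕ → Instr
  | .add => .add
  | .sub => .sub
  | .mul => .mul
  | .div => .div

/-- Expressions for numbers that depend on a host and on vertices of it, the variables. -/
inductive Expr where
  /-- a literal -/
  | const (c : ℕ)
  /-- the number of the vertex `v` -/
  | var (v : ℕ)
  /-- an arithmetic operation -/
  | op (o : BinOp) (e f : Expr)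
  /-- the sum over all vertices `v` -/
  | sumAll (v : ℕ) (e : Expr)
  /-- the sum over all entries `v` of the list of `u` -/
  | sumOut (u v : ℕ) (e : Expr)

namespace Expr

/-- The value of an expression. -/
def val {n : ℕ} (out : Fin n → List (Fin n)) : Expr → (ℕ → Fin n) → ℕ
  | const c, _ => c
  | var v, env => env v
  | op o e f, env => o.eval (e.val out env) (f.val out env)
  | sumAll v e, env => ((List.finRange n).map fun x => e.val out (Function.update env v x)).sum
  | sumOut u v e, env => ((out (env u)).map fun x => e.val out (Function.update env v x)).sum

/-- The nesting depth of sums over all vertices. -/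
def depth : Expr → ℕ
  | const _ => 0
  | var _ => 0
  | op _ e f => max e.depth f.depth
  | sumAll _ e => e.depth + 1
  | sumOut _ _ e => e.depth

/-- The number of memory cells used for the evaluation. -/
def regs : Expr → ℕ
  | const _ => 1
  | var _ => 1
  | op _ e f => e.regs + f.regs + 2
  | sumAll _ e => e.regs + 5
  | sumOut _ _ e => e.regs + 5

/-- A bound for the numbers in the evaluation if the number of vertices and the lengths of the
lists are at most `M`. -/
def bnd (M : ℕ) : Expr → ℕ
  | const c => c
  | var _ => M
  | op _ e f => e.bnd M * f.bnd M + e.bnd M + f.bnd M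
  | sumAll _ e => M * e.bnd M + e.bnd M + M + 1
  | sumOut _ _ e => M * e.bnd M + e.bnd M + M + 1

/-- A bound for the number of steps of the evaluation. -/
def cost (n d : ℕ) : Expr → ℕ
  | const _ => 1
  | var _ => 2
  | op _ e f => e.cost n d + f.cost n d + 1
  | sumAll _ e => n * (e.cost n d + 4) + 6
  | sumOut _ _ e => d * (e.cost n d + 4) + 6

end Expr

/-! ### Compilation of expressions into RAM programs -/

/-- A loop that adds up the values that `body` leaves in the cell `b + 5`; the cell `b + 1` counts,
`fetch` sets the loop variable in the cell `b + 2` and `limit` the number of rounds in the cell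
`b + 3`. -/
def loopCode (limit fetch : Instr) (b off : ℕ) (body : Program) : Program :=
  [.const b 0, .const (b + 1) 0, limit, .const (b + 4) 1,
    .jumpLt (b + 1) (b + 4) (off + body.length + 8), fetch] ++ body ++
  [.add b b (b + 5), .add (b + 1) (b + 1) (b + 4), .jumpLt (b + 1) (b + 3) (off + 5)]

/-- The code that evaluates an expression into the cell `b`, using no cells below `b` apart from
the cells `ρ v`, which hold the variables. -/
def Expr.compile : Expr → (ℕ → ℕ) → ℕ → ℕ → Program
  | .const c, _, b, _ => [.const b c]
  | .var v, ρ, b, _ => [.const b 0, .add b (ρ v) b]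
  | .op o e f, ρ, b, off =>
      let E := e.compile ρ b off
      E ++ f.compile ρ (b + 1) (off + E.length) ++ [o.instr b b (b + 1)]
  | .sumAll v e, ρ, b, off =>
      loopCode (.vertexCount (b + 3)) (.div (b + 2) (b + 1) (b + 4)) b off
        (e.compile (Function.update ρ v (b + 2)) (b + 5) (off + 6))
  | .sumOut u v e, ρ, b, off =>
      loopCode (.outDegree (b + 3) (ρ u)) (.outNeighbor (b + 2) (ρ u) (b + 1)) b off
        (e.compile (Function.update ρ v (b + 2)) (b + 5) (off + 6))

/-- The program `P` contains `code` from position `off` on. -/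
def HasCode (P : Program) (off : ℕ) (code : Program) : Prop :=
  ∃ A B, P = A ++ code ++ B ∧ A.length = off

theorem HasCode.left {P : Program} {off : ℕ} {c₁ c₂ : Program} (h : HasCode P off (c₁ ++ c₂)) :
    HasCode P off c₁ := by
  obtain ⟨A, B, rfl, rfl⟩ := h
  exact ⟨A, c₂ ++ B, by simp, rfl⟩

theorem HasCode.right {P : Program} {off : ℕ} {c₁ c₂ : Program} (h : HasCode P off (c₁ ++ c₂)) :
    HasCode P (off + c₁.length) c₂ := by
  obtain ⟨A, B, rfl, rfl⟩ := h
  exact ⟨A ++ c₁, B, by simp, by simp⟩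

theorem HasCode.get {P : Program} {off : ℕ} {code : Program} (h : HasCode P off code) {j : ℕ}
    {i : Instr} (hi : code[j]? = some i) : P[off + j]? = some i := by
  obtain ⟨A, B, rfl, rfl⟩ := h
  obtain ⟨hj, rfl⟩ := List.getElem?_eq_some_iff.mp hi
  simp [List.getElem?_append, hj]

section Compile

variable {n : ℕ} {P : Program} {out : Fin n → List (Fin n)} {W S : ℕ}

/-- Induction on the rounds, with partial sums as invariant. A round costs `T + 4` steps: test,
fetch, body, addition, increment. The constant 6 is made up of the five steps before the first test
and the final failing test. -/
theorem loopCode_spec {limit fetch : Instr} {b off T B : ℕ} {body : Program} {l : List (Fin n)}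
    {g : Fin n → ℕ} {m₀ : ℕ → ℕ} (hP : HasCode P off (loopCode limit fetch b off body))
    (hm₀ : Bounded W S m₀) (hS : b + 5 < S) (hg : ∀ x ∈ l, g x ≤ B)
    (hB : l.length * B ≤ W)
    (hl : l.length < W) (hn : n ≤ W)
    (hlimit : ∀ p m, (∀ a < b, m a = m₀ a) →
      limit.exec out ⟨p, m⟩ = Config.write ⟨p, m⟩ (b + 3) l.length)
    (hfetch : ∀ p m (x : Fin n), (∀ a < b, m a = m₀ a) → m (b + 4) = 1 →
      l[m (b + 1)]? = some x → fetch.exec out ⟨p, m⟩ = Config.write ⟨p, m⟩ (b + 2) x)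
    (hbody : ∀ m (x : Fin n), Bounded W S m → (∀ a < b, m a = m₀ a) → m (b + 2) = x →
      x ∈ l → ∃ m', Leads P out W S T ⟨off + 6, m⟩ ⟨off + 6 + body.length, m'⟩ ∧
        m' (b + 5) = g x ∧ ∀ a < b + 5, m' a = m a) :
    ∃ m', Leads P out W S (l.length * (T + 4) + 6) ⟨off, m₀⟩
        ⟨off + (loopCode limit fetch b off body).length, m'⟩ ∧
      m' b = (l.map g).sum ∧ ∀ a < b, m' a = m₀ a := by
  have hlen : (loopCode limit fetch b off body).length = body.length + 9 := by
    simp [loopCode]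
  rw [hlen]
  have hsum : ∀ j ≤ l.length, ((l.take j).map g).sum ≤ l.length * B := by
    intro j hj
    refine (List.sum_le_card_nsmul _ B ?_).trans ?_
    · simp only [List.mem_map]
      rintro _ ⟨x, hx, rfl⟩
      exact hg x (List.mem_of_mem_take hx)
    · simp only [List.length_map, List.length_take, smul_eq_mul]
      exact Nat.mul_le_mul_right _ (by omega)
  have c0 : P[off + 0]? = some (.const b 0) := hP.get (by simp [loopCode])
  have c1 : P[off + 1]? = some (.const (b + 1) 0) := hP.get (by simp [loopCode])
  have c2 : P[off + 2]? = some limit := hP.get (by simp [loopCode])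
  have c3 : P[off + 3]? = some (.const (b + 4) 1) := hP.get (by simp [loopCode])
  have c4 : P[off + 4]? = some (.jumpLt (b + 1) (b + 4) (off + body.length + 8)) :=
    hP.get (by simp [loopCode])
  have c5 : P[off + 5]? = some fetch := hP.get (by simp [loopCode])
  have c6 : P[off + 6 + body.length]? = some (.add b b (b + 5)) := by
    rw [add_assoc]
    exact hP.get (by simp [loopCode, add_comm 6])
  have c7 : P[off + 6 + body.length + 1]? = some (.add (b + 1) (b + 1) (b + 4)) := by
    rw [add_assoc, add_assoc]
    refine hP.get ?_
    rw [loopCode, List.getElem?_append_right (by simp; omega)]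
    simp only [List.length_append, List.length_cons, List.length_nil]
    rw [show 6 + (body.length + 1) - (0 + 1 + 1 + 1 + 1 + 1 + 1 + body.length) = 1 by omega]
    rfl
  have c8 : P[off + body.length + 8]? = some (.jumpLt (b + 1) (b + 3) (off + 5)) := by
    rw [add_assoc]
    refine hP.get ?_
    rw [loopCode, List.getElem?_append_right (by simp)]
    simp only [List.length_append, List.length_cons, List.length_nil]
    rw [show body.length + 8 - (0 + 1 + 1 + 1 + 1 + 1 + 1 + body.length) = 2 by omega]
    rfl
  -- the invariant at the test at the end of the loop
  let Inv (j : ℕ) (m : ℕ → ℕ) : Prop := m b = ((l.take j).map g).sum ∧ m (b + 1) = j ∧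
    m (b + 3) = l.length ∧ m (b + 4) = 1 ∧ ∀ a < b, m a = m₀ a
  have hinit : ∃ m, Leads P out W S 5 ⟨off, m₀⟩ ⟨off + body.length + 8, m⟩ ∧ Inv 0 m := by
    have s0 := Leads.write (out := out) (W := W) (S := S) c0 hm₀ rfl (by omega) (by omega)
    have s1 := Leads.write (out := out) c1 s0.bounded rfl (by omega) (by omega)
    have s2 := Leads.write (out := out) c2 s1.bounded (hlimit _ _ ?_) (by omega) (by omega)
    have s3 := Leads.write (out := out) c3 s2.bounded rfl (by omega) (by omega)
    -- The jump is always taken, since it compares 0 with 1. The test thus precedes the first round,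
    -- and empty lists are handled correctly.
    · refine ⟨_, ((((s0.trans s1).trans s2).trans s3).trans
        (Leads.single (c' := ⟨off + body.length + 8, _⟩) c4 s3.bounded ?_ s3.bounded)), ?_⟩
      · simp [Instr.exec]
      · refine ⟨by simp, by simp, by simp, by simp, fun a ha => ?_⟩
        simp only [Function.update_of_ne (show a ≠ b by omega),
          Function.update_of_ne (show a ≠ b + 1 by omega),
          Function.update_of_ne (show a ≠ b + 3 by omega),
          Function.update_of_ne (show a ≠ b + 4 by omega)]
    · intro a ha
      simp only [Function.update_of_ne (show a ≠ b by omega),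
        Function.update_of_ne (show a ≠ b + 1 by omega)]
  have hround : ∀ j < l.length, ∀ m, Bounded W S m → Inv j m →
      ∃ m', Leads P out W S (T + 4) ⟨off + body.length + 8, m⟩ ⟨off + body.length + 8, m'⟩ ∧
        Inv (j + 1) m' := by
    rintro j hj m hm ⟨i1, i2, i3, i4, i5⟩
    have s0 : Leads P out W S 1 ⟨off + body.length + 8, m⟩ ⟨off + 5, m⟩ :=
      Leads.single c8 hm (by simp [Instr.exec, i2, i3, hj]) hm
    have hx : l[m (b + 1)]? = some l[j] := by simp [i2]
    have hxl : l[j] ∈ l := List.getElem_mem hj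
    have s1 := Leads.write (out := out) c5 hm (hfetch _ _ _ i5 i4 hx) (by omega)
      (by have := l[j].isLt; omega)
    obtain ⟨m₁, s2, hv, hlow⟩ := hbody (Function.update m (b + 2) l[j]) l[j]
      s1.bounded (fun a ha => by
      rw [Function.update_of_ne (by omega)]; exact i5 a ha) (by simp) hxl
    have e0 : m₁ b = ((l.take j).map g).sum := by
      rw [hlow _ (by omega), Function.update_of_ne (by omega), i1]
    have e1 : m₁ (b + 1) = j := by
      rw [hlow _ (by omega), Function.update_of_ne (by omega), i2]
    have e3 : m₁ (b + 3) = l.length := by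
      rw [hlow _ (by omega), Function.update_of_ne (by omega), i3]
    have e4 : m₁ (b + 4) = 1 := by
      rw [hlow _ (by omega), Function.update_of_ne (by omega), i4]
    have hnext : m₁ b + m₁ (b + 5) = ((l.take (j + 1)).map g).sum := by
      rw [e0, hv, List.take_succ_eq_append_getElem hj, List.map_append, List.sum_append]; simp
    have s3 := Leads.write (out := out) (x := m₁ b + m₁ (b + 5)) c6 s2.bounded rfl (by omega)
      (by rw [hnext]; have := hsum (j + 1) hj; omega)
    have s4 := Leads.write (out := out) (a := b + 1) (x := j + 1) c7 s3.bounded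
      (by simp [Instr.exec, e1, e4]) (by omega) (by omega)
    have e : off + 6 + body.length + 1 + 1 = off + body.length + 8 := by omega
    rw [e] at s4
    refine ⟨_, (s0.trans (s1.trans (s2.trans (s3.trans s4)))).mono (by omega), ?_⟩
    refine ⟨?_, by simp, ?_, ?_, fun a ha => ?_⟩ <;> dsimp only
    · rw [Function.update_of_ne (by omega), Function.update_self, hnext]
    · rw [Function.update_of_ne (by omega), Function.update_of_ne (by omega), e3]
    · rw [Function.update_of_ne (by omega), Function.update_of_ne (by omega), e4]
    · rw [Function.update_of_ne (by omega), Function.update_of_ne (by omega), hlow _ (by omega),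
        Function.update_of_ne (by omega), i5 a ha]
  have hall : ∀ j ≤ l.length, ∃ m, Leads P out W S (j * (T + 4) + 5) ⟨off, m₀⟩
      ⟨off + body.length + 8, m⟩ ∧ Inv j m := by
    intro j
    induction j with
    | zero => intro _; simpa using hinit
    | succ j ih =>
      intro hj
      obtain ⟨m, h, hi⟩ := ih (by omega)
      obtain ⟨m', h', hi'⟩ := hround j hj m h.bounded hi
      exact ⟨m', (h.trans h').mono (by rw [add_mul]; omega), hi'⟩
  obtain ⟨m, h, i1, i2, i3, i4, i5⟩ := hall _ le_rfl
  refine ⟨m, (h.trans (Leads.single c8 h.bounded (c' := ⟨off + (body.length + 9), m⟩) ?_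
    h.bounded)).mono (by omega), by simpa using i1, i5⟩
  simp only [Instr.exec, i2, i3, lt_irrefl, if_false]
  congr 1

theorem Expr.val_le_bnd {d M : ℕ} (hn : n ≤ M) (hd : d ≤ M) (hout : ∀ v, (out v).length ≤ d)
    (e : Expr) : ∀ env, e.val out env ≤ e.bnd M := by
  have hlist : ∀ (l : List (Fin n)) (g : Fin n → ℕ) (B : ℕ), l.length ≤ M → (∀ x, g x ≤ B) →
      (l.map g).sum ≤ M * B + B + M + 1 := by
    intro l g B hl hg
    have h := List.sum_le_card_nsmul (l.map g) B (by simp [hg])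
    have := Nat.mul_le_mul_right B hl
    simp only [List.length_map, smul_eq_mul] at h
    omega
  induction e with
  | const c => intro env; rfl
  | var v => intro env; exact (env v).isLt.le.trans hn
  | op o e f ihe ihf =>
    intro env
    have he := ihe env
    have hf := ihf env
    have hmul := Nat.mul_le_mul he hf
    have hdiv := Nat.div_le_self (e.val out env) (f.val out env)
    simp only [val, bnd]
    cases o <;> simp only [BinOp.eval] <;> omega
  | sumAll v e ih =>
    intro env
    exact hlist _ _ _ (by simpa using hn) fun x => ih _
  | sumOut u v e ih =>
    intro env
    exact hlist _ _ _ ((hout _).trans hd) fun x => ih _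

/-- The preservation of all cells below `b` is what makes the induction work: the variables lie
there, and a subexpression evaluated from a higher cell on cannot destroy partial results of the
surrounding one. -/
theorem Expr.compile_spec {d M : ℕ} (hn : n ≤ M) (hd : d ≤ M) (hout : ∀ v, (out v).length ≤ d)
    (e : Expr) : ∀ (ρ : ℕ → ℕ) (b off : ℕ) (m : ℕ → ℕ) (env : ℕ → Fin n),
      HasCode P off (e.compile ρ b off) → (∀ u, ρ u < b) → (∀ u, m (ρ u) = env u) →
      Bounded W S m → b + e.regs ≤ S → e.bnd M ≤ W →
      ∃ m', Leads P out W S (e.cost n d) ⟨off, m⟩ ⟨off + (e.compile ρ b off).length, m'⟩ ∧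
        m' b = e.val out env ∧ ∀ a < b, m' a = m a := by
  induction e with
  | const c =>
    intro ρ b off m env hP hρ henv hm hS hW
    simp only [regs, bnd] at hS hW
    have c0 : P[off + 0]? = some (.const b c) := hP.get (by simp [compile])
    exact ⟨_, Leads.write (out := out) c0 hm rfl (by omega) hW, by simp [val],
      fun a ha => Function.update_of_ne (by omega) ..⟩
  | var v =>
    intro ρ b off m env hP hρ henv hm hS hW
    simp only [regs, bnd] at hS hW
    have c0 : P[off + 0]? = some (.const b 0) := hP.get (by simp [compile])
    have c1 : P[off + 1]? = some (.add b (ρ v) b) := hP.get (by simp [compile])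
    have s0 := Leads.write (out := out) (W := W) (S := S) c0 hm rfl (by omega) (by omega)
    have s1 := Leads.write (out := out) (a := b) (x := env v) c1 s0.bounded
      (by simp [Instr.exec, Function.update_of_ne (hρ v).ne, henv]) (by omega)
      ((env v).isLt.le.trans (hn.trans hW))
    exact ⟨_, s0.trans s1, by simp [val], fun a ha => by
      simp only [Function.update_of_ne (show a ≠ b by omega)]⟩
  | op o e f ihe ihf =>
    intro ρ b off m env hP hρ henv hm hS hW
    have hval : (op o e f).val out env ≤ W := (val_le_bnd hn hd hout _ env).trans hW
    simp only [regs, bnd] at hS hW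
    simp only [compile] at hP ⊢
    obtain ⟨m₁, h₁, v₁, l₁⟩ := ihe ρ b off m env hP.left.left hρ henv hm (by omega)
      (by omega)
    obtain ⟨m₂, h₂, v₂, l₂⟩ := ihf ρ (b + 1) _ m₁ env hP.left.right
      (fun u => (hρ u).trans (by omega)) (fun u => by rw [l₁ _ (hρ u), henv]) h₁.bounded
      (by omega) (by omega)
    have c0 := hP.right.get (j := 0) (i := o.instr b b (b + 1)) (by simp)
    have s0 := Leads.write (out := out) (x := (op o e f).val out env) c0
      (by simpa [add_assoc] using h₂.bounded)
      (a := b) (by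
        have e₁ : m₂ b = e.val out env := by rw [l₂ _ (by omega), v₁]
        cases o <;> simp [BinOp.instr, Instr.exec, e₁, v₂, val, BinOp.eval]) (by omega) hval
    refine ⟨_, (h₁.trans (h₂.trans (by simpa [add_assoc] using s0))).mono
      (by simp only [cost]; omega), by simp, fun a ha => ?_⟩
    rw [Function.update_of_ne (by omega), l₂ _ (by omega), l₁ _ ha]
  | sumAll v e ih =>
    intro ρ b off m env hP hρ henv hm hS hW
    simp only [regs, bnd] at hS hW
    have hregs : 1 ≤ e.regs := by cases e <;> simp [regs]
    have hmul := Nat.mul_le_mul_right (e.bnd M) hn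
    obtain ⟨m', h₁, h₂, h₃⟩ := loopCode_spec (out := out) (W := W) (S := S) (T := e.cost n d)
      (B := e.bnd M) (l := List.finRange n)
      (g := fun x => e.val out (Function.update env v x)) hP hm (by omega)
      (fun x _ => val_le_bnd hn hd hout e _) (by rw [List.length_finRange]; omega)
      (by rw [List.length_finRange]; omega) (by omega)
      (fun p m _ => by simp [Instr.exec])
      -- The fetch instruction divides the counter by the cell `b + 4`, which holds 1, and so copies
      -- the counter: round `j` treats the vertex `j`.
      (fun p m x _ h4 hx => by
        obtain ⟨hj, rfl⟩ := List.getElem?_eq_some_iff.mp hx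
        simp [Instr.exec, h4])
      (fun m₁ x hm₁ hlow hx _ => ih _ _ _ m₁ _ hP.left.right
        (fun u => by
          by_cases hu : u = v
          · subst hu; simp
          · simp only [Function.update_of_ne hu]; have := hρ u; omega)
        (fun u => by
          by_cases hu : u = v
          · subst hu; simpa using hx
          · simp only [Function.update_of_ne hu]; rw [hlow _ (hρ u), henv])
        hm₁ (by omega) (by omega))
    exact ⟨m', by rw [List.length_finRange] at h₁; exact h₁, h₂, h₃⟩
  | sumOut u v e ih =>
    intro ρ b off m env hP hρ henv hm hS hW
    simp only [regs, bnd] at hS hW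
    have hregs : 1 ≤ e.regs := by cases e <;> simp [regs]
    have hlen := hout (env u)
    have hmul := Nat.mul_le_mul_right (e.bnd M) (hlen.trans hd)
    obtain ⟨m', h₁, h₂, h₃⟩ := loopCode_spec (out := out) (W := W) (S := S) (T := e.cost n d)
      (B := e.bnd M) (l := out (env u))
      (g := fun x => e.val out (Function.update env v x)) hP hm (by omega)
      (fun x _ => val_le_bnd hn hd hout e _) (by omega) (by omega) (by omega)
      (fun p m' h => by
        have := h _ (hρ u)
        simp [Instr.exec, this, henv])
      (fun p m' x h _ hx => by
        have := h _ (hρ u)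
        simp [Instr.exec, this, henv, hx])
      (fun m₁ x hm₁ hlow hx _ => ih _ _ _ m₁ _ hP.left.right
        (fun u => by
          by_cases hu : u = v
          · subst hu; simp
          · simp only [Function.update_of_ne hu]; have := hρ u; omega)
        (fun u => by
          by_cases hu : u = v
          · subst hu; simpa using hx
          · simp only [Function.update_of_ne hu]; rw [hlow _ (hρ u), henv])
        hm₁ (by omega) (by omega))
    refine ⟨m', h₁.mono ?_, h₂, h₃⟩
    simp only [cost]
    gcongr

end Compile

/-! ### Time and space of the evaluation -/

/-- Only `sumAll` multiplies the cost by `n`. A sum over a list contributes a factor `d`, absorbed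
by `F d`, and both arguments of an operation are evaluated one after the other, so the larger depth
counts. -/
theorem Expr.cost_le (e : Expr) :
    ∃ F : ℕ → ℕ, ∀ d n, 1 ≤ n → e.cost n d ≤ F d * n ^ e.depth := by
  induction e with
  | const c => exact ⟨fun _ => 1, fun d n _ => by simp [cost, depth]⟩
  | var v => exact ⟨fun _ => 2, fun d n _ => by simp [cost, depth]⟩
  | op o e f ihe ihf =>
    obtain ⟨F, hF⟩ := ihe
    obtain ⟨F', hF'⟩ := ihf
    refine ⟨fun d => F d + F' d + 1, fun d n hn => ?_⟩
    have h₁ : n ^ e.depth ≤ n ^ max e.depth f.depth := Nat.pow_le_pow_right hn (le_max_left _ _)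
    have h₂ : n ^ f.depth ≤ n ^ max e.depth f.depth := Nat.pow_le_pow_right hn (le_max_right _ _)
    have h₃ : 1 ≤ n ^ max e.depth f.depth := Nat.one_le_pow _ _ hn
    have h₄ := (hF d n hn).trans (Nat.mul_le_mul_left _ h₁)
    have h₅ := (hF' d n hn).trans (Nat.mul_le_mul_left _ h₂)
    simp only [cost, depth, add_mul]
    omega
  | sumAll v e ih =>
    obtain ⟨F, hF⟩ := ih
    refine ⟨fun d => F d + 10, fun d n hn => ?_⟩
    have h₁ : 1 ≤ n ^ e.depth := Nat.one_le_pow _ _ hn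
    have h₂ : 1 ≤ n ^ e.depth * n := Nat.mul_pos h₁ hn
    have h₃ := Nat.mul_le_mul_left n (hF d n hn)
    have h₄ := Nat.mul_le_mul_left n h₁
    simp only [cost, depth, pow_succ]
    nlinarith
  | sumOut u v e ih =>
    obtain ⟨F, hF⟩ := ih
    refine ⟨fun d => d * (F d + 4) + 6, fun d n hn => ?_⟩
    have h₁ : 1 ≤ n ^ e.depth := Nat.one_le_pow _ _ hn
    have h₃ := Nat.mul_le_mul_left d (hF d n hn)
    have h₄ := Nat.mul_le_mul_left d h₁
    simp only [cost, depth]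
    nlinarith

theorem Expr.bnd_le (e : Expr) : ∃ p : ℕ, ∀ M, 1 ≤ M → e.bnd M ≤ p * M ^ p := by
  have hpow : ∀ M, 1 ≤ M → ∀ p q, p ≤ q → p * M ^ p ≤ p * M ^ q := fun M hM p q h =>
    Nat.mul_le_mul_left _ (Nat.pow_le_pow_right hM h)
  have hloop : ∀ e : Expr, (∃ p : ℕ, ∀ M, 1 ≤ M → e.bnd M ≤ p * M ^ p) →
      ∃ p : ℕ, ∀ M, 1 ≤ M → M * e.bnd M + e.bnd M + M + 1 ≤ p * M ^ p := by
    rintro e ⟨p, hp⟩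
    refine ⟨p + p + 2, fun M hM => ?_⟩
    have h₁ := (hp M hM).trans (hpow M hM p (p + p + 1) (by omega))
    have h₂ : 1 ≤ M ^ (p + p + 1) := Nat.one_le_pow _ _ hM
    have h₃ := Nat.mul_le_mul_left M h₁
    have h₄ := Nat.mul_le_mul_right (M ^ (p + p + 1)) (Nat.mul_le_mul_left p hM)
    have h₅ := Nat.mul_le_mul_left M h₂
    have h₆ := Nat.mul_le_mul hM h₂
    rw [show M ^ (p + p + 2) = M * M ^ (p + p + 1) by rw [← pow_succ']]
    nlinarith
  induction e with
  | const c => exact ⟨c, fun M hM => Nat.le_mul_of_pos_right _ (Nat.one_le_pow _ _ hM)⟩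
  | var v => exact ⟨1, fun M hM => by simp [bnd]⟩
  | op o e f ihe ihf =>
    obtain ⟨p, hp⟩ := ihe
    obtain ⟨q, hq⟩ := ihf
    refine ⟨p * q + p + q, fun M hM => ?_⟩
    have h₁ := (hp M hM).trans (hpow M hM p (p * q + p + q) (by nlinarith))
    have h₂ := (hq M hM).trans (hpow M hM q (p * q + p + q) (by nlinarith))
    have h₃ := Nat.mul_le_mul (hp M hM) (hq M hM)
    have h₄ : p * q * M ^ (p + q) ≤ p * q * M ^ (p * q + p + q) :=
      Nat.mul_le_mul_left _ (Nat.pow_le_pow_right hM (by nlinarith))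
    have h₅ : p * M ^ p * (q * M ^ q) = p * q * M ^ (p + q) := by ring
    simp only [bnd, add_mul]
    omega
  | sumAll v e ih => exact hloop e ih
  | sumOut u v e ih => exact hloop e ih

theorem ComputesWithin.mono {n : ℕ} {P : Program} {out : Fin n → List (Fin n)}
    {r T T' S S' W W' : ℕ} (h : ComputesWithin P out r T S W) (hT : T ≤ T') (hS : S ≤ S')
    (hW : W ≤ W') : ComputesWithin P out r T' S' W' := by
  obtain ⟨t, ht, h₁, h₂, h₃⟩ := h
  exact ⟨t, ht.trans hT, h₁, h₂, fun j hj a =>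
    ⟨(h₃ j hj a).1.trans hW, fun ha => (h₃ j hj a).2 (hS.trans ha)⟩⟩

/-- Closed expressions are computed in time `O(n ^ depth)` and constant space. -/
theorem Expr.exists_program (e : Expr) : ∃ (P : Program) (f s : ℕ → ℕ), ∀ d n, ∀ hn : 1 ≤ n,
    ∀ out : Fin n → List (Fin n), (∀ v, (out v).length ≤ d) →
      ComputesWithin P out (e.val out fun _ => ⟨0, hn⟩) (f d * n ^ e.depth) (s d)
        (s d * n ^ s d) := by
  obtain ⟨F, hF⟩ := e.cost_le
  obtain ⟨p, hp⟩ := e.bnd_le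
  -- Cell 0, initially 0, represents every variable as the vertex 0. The result is computed in cell
  -- 1 and then copied to cell 0 by the two extra instructions.
  refine ⟨e.compile (fun _ => 0) 1 0 ++ [.const 0 0, .add 0 0 1], fun d => F d + 2,
    fun d => p * (d + 1) ^ p + p + e.regs + 1, fun d n hn out hout => ?_⟩
  set P := e.compile (fun _ => 0) 1 0 ++ [.const 0 0, .add 0 0 1] with hP
  have hcode : HasCode P 0 P := ⟨[], [], by simp, rfl⟩
  set W := e.bnd (n + d) with hW
  have h0 : Bounded W (e.regs + 1) (fun _ => 0) := fun a => ⟨Nat.zero_le _, fun _ => rfl⟩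
  obtain ⟨m, h₁, h₂, -⟩ := e.compile_spec (P := P) (W := W) (S := e.regs + 1)
    (Nat.le_add_right n d) (Nat.le_add_left d n) hout (fun _ => 0) 1 0 (fun _ => 0)
    (fun _ => ⟨0, hn⟩) hcode.left (by simp) (by simp) h0 (by omega) le_rfl
  have c0 := hcode.right.get (j := 0) (i := .const 0 0) (by simp)
  have c1 := hcode.right.get (j := 1) (i := .add 0 0 1) (by simp)
  have s0 := Leads.write (out := out) c0 h₁.bounded rfl (by omega) (Nat.zero_le _)
  have s1 := Leads.write (out := out) (a := 0) (x := m 1) c1 s0.bounded (by simp [Instr.exec])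
    (by omega) (h₁.bounded 1).1
  obtain ⟨t, ht, he, hb⟩ := h₁.trans (s0.trans s1)
  have hM : n + d ≤ (d + 1) * n := by nlinarith
  have hWle : W ≤ p * (d + 1) ^ p * n ^ p :=
    (hp _ (by omega)).trans (by
      rw [mul_assoc, ← mul_pow]; exact Nat.mul_le_mul_left _ (Nat.pow_le_pow_left hM _))
  refine ⟨t, ht.trans ?_, ?_, ?_, fun j hj a => ⟨(hb j hj a).1.trans (hWle.trans ?_),
    fun ha => (hb j hj a).2 (by beta_reduce at ha; omega)⟩⟩
  · have := hF d n hn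
    have := Nat.one_le_pow e.depth n hn
    rw [add_mul]; omega
  · show Config.Halted P ((step P out)^[t] ⟨0, fun _ => 0⟩)
    rw [he]
    simp [Config.Halted, hP]
  · show ((step P out)^[t] ⟨0, fun _ => 0⟩).mem 0 = _
    rw [he]
    simpa using h₂
  · beta_reduce
    exact Nat.mul_le_mul (by omega) (Nat.pow_le_pow_right hn (by omega))

/-! ### Counting the extensions of partial maps that respect arcs -/

section Extensions

variable {V : Type} {n : ℕ}

/-- The maps that agree with `env` off `X` and respect all arcs of `D` that touch `X`. -/
def extensions (out : Fin n → List (Fin n)) (D : V → V → Prop) (X : Finset V) (env : V → Fin n) :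
    Set (V → Fin n) :=
  {φ | (∀ a ∉ X, φ a = env a) ∧ ∀ a b, D a b → a ∈ X ∨ b ∈ X → φ b ∈ out (φ a)}

theorem extensions_empty (out : Fin n → List (Fin n)) (D : V → V → Prop) (env : V → Fin n) :
    extensions out D ∅ env = {env} := by
  ext φ
  simp [extensions, funext_iff]

variable [DecidableEq V]

/-- With the image of `v` fixed, the arcs touching `X` split into those touching `X.erase v` and
those at `v` whose ends are all determined. The latter become a test on known images. -/
theorem mem_extensions_and_eq_iff {out : Fin n → List (Fin n)} {D : V → V → Prop} {X : Finset V}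
    {env φ : V → Fin n} {v : V} (hv : v ∈ X) (x : Fin n) :
    φ ∈ extensions out D X env ∧ φ v = x ↔
      (∀ a b, D a b → (a = v ∨ b = v) ∧ a ∉ X.erase v ∧ b ∉ X.erase v →
        Function.update env v x b ∈ out (Function.update env v x a)) ∧
      φ ∈ extensions out D (X.erase v) (Function.update env v x) := by
  constructor
  · rintro ⟨⟨h₁, h₂⟩, rfl⟩
    have h : ∀ a ∉ X.erase v, φ a = Function.update env v (φ v) a := by
      intro a ha
      by_cases hav : a = v
      · subst hav; simp
      · rw [Function.update_of_ne hav]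
        exact h₁ a fun haX => ha (Finset.mem_erase.mpr ⟨hav, haX⟩)
    refine ⟨fun a b hD hab => ?_, h, fun a b hD hab => ?_⟩
    · rw [← h a hab.2.1, ← h b hab.2.2]
      exact h₂ a b hD (hab.1.imp (by rintro rfl; exact hv) (by rintro rfl; exact hv))
    · exact h₂ a b hD (hab.imp Finset.mem_of_mem_erase Finset.mem_of_mem_erase)
  · rintro ⟨hT, h₁, h₂⟩
    refine ⟨⟨fun a ha => ?_, fun a b hD hab => ?_⟩, ?_⟩
    · rw [h₁ a fun h => ha (Finset.mem_of_mem_erase h),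
        Function.update_of_ne (by rintro rfl; exact ha hv)]
    · by_cases h : a ∈ X.erase v ∨ b ∈ X.erase v
      · exact h₂ a b hD h
      · rw [not_or] at h
        rw [h₁ a h.1, h₁ b h.2]
        refine hT a b hD ⟨?_, h⟩
        simp only [Finset.mem_erase, not_and, ne_eq] at h
        by_contra hne
        rw [not_or] at hne
        exact hab.elim (h.1 hne.1) (h.2 hne.2)
    · simpa using h₁ v (by simp)

-- The maps are sorted by the image of `v`. Any list without repetitions that contains all possible
-- images will do: the list of all vertices, or the out-list of a vertex already placed.
open Classical in
theorem ncard_extensions_eq_sum [Fintype V] {out : Fin n → List (Fin n)} {D : V → V → Prop}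
    {X : Finset V} {env : V → Fin n} {v : V} (hv : v ∈ X) {l : List (Fin n)} (hl : l.Nodup)
    (hmem : ∀ φ ∈ extensions out D X env, φ v ∈ l) :
    (extensions out D X env).ncard = (l.map fun x =>
      (if ∀ a b, D a b → (a = v ∨ b = v) ∧ a ∉ X.erase v ∧ b ∉ X.erase v →
        Function.update env v x b ∈ out (Function.update env v x a) then 1 else 0) *
      (extensions out D (X.erase v) (Function.update env v x)).ncard).sum := by
  rw [← List.sum_toFinset _ hl, Set.ncard_eq_toFinset_card',
    Finset.card_eq_sum_card_fiberwise (f := fun φ => φ v) (t := l.toFinset)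
      (fun φ hφ => by simpa using hmem φ (by simpa using hφ))]
  refine Finset.sum_congr rfl fun x _ => ?_
  have key := fun φ => mem_extensions_and_eq_iff (out := out) (D := D) (env := env) (φ := φ) hv x
  split_ifs with hT
  · rw [one_mul, Set.ncard_eq_toFinset_card']
    congr 1
    ext φ
    have := key φ
    simp only [Finset.mem_filter, Set.mem_toFinset]
    tauto
  · rw [zero_mul, Finset.card_eq_zero, Finset.eq_empty_iff_forall_notMem]
    intro φ hφ
    simp only [Finset.mem_filter, Set.mem_toFinset] at hφ
    exact hT ((key φ).mp hφ).1

/-- Each arc touching `X ∪ Y` has free ends in only one of the two sets, so the choices on `X` and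
on `Y` are independent. -/
theorem ncard_extensions_union {out : Fin n → List (Fin n)} {D : V → V → Prop} {X Y : Finset V}
    (hXY : Disjoint X Y) (hD : ∀ a ∈ X, ∀ b ∈ Y, ¬ D a b ∧ ¬ D b a) (env : V → Fin n) :
    (extensions out D (X ∪ Y) env).ncard =
      (extensions out D X env).ncard * (extensions out D Y env).ncard := by
  have hY : ∀ a ∈ Y, a ∉ X := fun a ha hX => Finset.disjoint_left.mp hXY hX ha
  rw [← Nat.card_coe_set_eq, ← Nat.card_coe_set_eq, ← Nat.card_coe_set_eq, ← Nat.card_prod]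
  refine Nat.card_congr
    { toFun := fun φ => (⟨X.piecewise φ.1 env, ?_, ?_⟩, ⟨Y.piecewise φ.1 env, ?_, ?_⟩)
      invFun := fun p => ⟨X.piecewise p.1.1 p.2.1, ?_, ?_⟩
      left_inv := ?_
      right_inv := ?_ }
  · intro a ha; simp [ha]
  · obtain ⟨φ, h₁, h₂⟩ := φ
    have h : ∀ a, a ∉ Y → X.piecewise φ env a = φ a := by
      intro a ha
      by_cases hX : a ∈ X
      · simp [hX]
      · simp [hX, h₁ a (by simp [hX, ha])]
    intro a b hab hm
    have ha : a ∉ Y := fun ha => hm.elim (hY a ha) fun hb => (hD b hb a ha).2 hab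
    have hb : b ∉ Y := fun hb => hm.elim (fun ha => (hD a ha b hb).1 hab) (hY b hb)
    rw [h a ha, h b hb]
    exact h₂ a b hab (hm.imp (by simp +contextual) (by simp +contextual))
  · intro a ha; simp [ha]
  · obtain ⟨φ, h₁, h₂⟩ := φ
    have h : ∀ a, a ∉ X → Y.piecewise φ env a = φ a := by
      intro a ha
      by_cases hX : a ∈ Y
      · simp [hX]
      · simp [hX, h₁ a (by simp [hX, ha])]
    intro a b hab hm
    have ha : a ∉ X := fun ha => hm.elim (fun h => hY a h ha) fun hb => (hD a ha b hb).1 hab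
    have hb : b ∉ X := fun hb => hm.elim (fun ha => (hD b hb a ha).2 hab) (fun h => hY b h hb)
    rw [h a ha, h b hb]
    exact h₂ a b hab (hm.imp (by simp +contextual) (by simp +contextual))
  · obtain ⟨⟨φ, h₁, h₂⟩, ⟨ψ, h₃, h₄⟩⟩ := p
    intro a ha
    simp only [Finset.mem_union, not_or] at ha
    simp [ha.1, h₃ a ha.2]
  · obtain ⟨⟨φ, h₁, h₂⟩, ⟨ψ, h₃, h₄⟩⟩ := p
    have hφ : ∀ a, a ∉ Y → X.piecewise φ ψ a = φ a := by
      intro a ha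
      by_cases hX : a ∈ X
      · simp [hX]
      · simp [hX, h₃ a ha, h₁ a hX]
    have hψ : ∀ a, a ∉ X → X.piecewise φ ψ a = ψ a := fun a ha => by simp [ha]
    intro a b hab hm
    show X.piecewise φ ψ b ∈ out (X.piecewise φ ψ a)
    by_cases hX : a ∈ X ∨ b ∈ X
    · have ha : a ∉ Y := fun ha => hX.elim (hY a ha) fun hb => (hD b hb a ha).2 hab
      have hb : b ∉ Y := fun hb => hX.elim (fun ha => (hD a ha b hb).1 hab) (hY b hb)
      rw [hφ a ha, hφ b hb]
      exact h₂ a b hab hX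
    · rw [not_or] at hX
      rw [hψ a hX.1, hψ b hX.2]
      refine h₄ a b hab ?_
      simpa [hX.1, hX.2] using hm
  · rintro ⟨φ, h₁, h₂⟩
    ext a
    by_cases hX : a ∈ X
    · simp [hX]
    · by_cases haY : a ∈ Y
      · simp [hX, haY]
      · simp [hX, haY, h₁ a (by simp [hX, haY])]
  · rintro ⟨⟨φ, h₁, h₂⟩, ⟨ψ, h₃, h₄⟩⟩
    ext a
    · by_cases hX : a ∈ X
      · simp [hX]
      · simp [hX, h₁ a hX]
    · by_cases haY : a ∈ Y
      · simp [hY a haY, haY]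
      · simp [haY, h₃ a haY]

end Extensions

/-! ### Expressions for numbers of extensions -/

/-- `1` if the variables `u` and `v` agree and `0` otherwise. -/
def Expr.eqTest (u v : ℕ) : Expr :=
  .op .sub (.const 1) (.op .add (.op .sub (.var u) (.var v)) (.op .sub (.var v) (.var u)))

/-- With truncated subtraction, `(u - v) + (v - u)` is the distance of `u` and `v`; it vanishes
exactly if they agree. -/
theorem Expr.val_eqTest {n : ℕ} (out : Fin n → List (Fin n)) (u v : ℕ) (env : ℕ → Fin n) :
    (eqTest u v).val out env = if env u = env v then 1 else 0 := by
  simp only [eqTest, val, BinOp.eval, Fin.ext_iff]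
  split_ifs <;> omega

/-- `1` if `v` is in the list of `u` and `0` otherwise; `w` is an auxiliary variable. -/
def Expr.arcTest (w u v : ℕ) : Expr := .sumOut u w (eqTest w v)

theorem Expr.val_arcTest {n : ℕ} {out : Fin n → List (Fin n)} (hout : ∀ v, (out v).Nodup)
    {u v w : ℕ} (hw : v ≠ w) (env : ℕ → Fin n) :
    (arcTest w u v).val out env = if env v ∈ out (env u) then 1 else 0 := by
  simp only [arcTest, val, val_eqTest, Function.update_self, Function.update_of_ne hw]
  have : ∀ l : List (Fin n), l.Nodup → (l.map fun x => if x = env v then 1 else 0).sum =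
      if env v ∈ l then 1 else 0 := by
    intro l hl
    rw [← List.sum_toFinset _ hl]
    simp
  exact this _ (hout _)

/-- `1` if all arcs of a list are respected and `0` otherwise. -/
def Expr.arcTests (w : ℕ) : List (ℕ × ℕ) → Expr
  | [] => .const 1
  | a :: L => .op .mul (arcTest w a.1 a.2) (arcTests w L)

theorem Expr.depth_arcTests (w : ℕ) (L : List (ℕ × ℕ)) : (arcTests w L).depth = 0 := by
  induction L with
  | nil => rfl
  | cons a L ih => simp [arcTests, depth, ih, arcTest, eqTest]

theorem Expr.val_arcTests {n : ℕ} {out : Fin n → List (Fin n)} (hout : ∀ v, (out v).Nodup)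
    {w : ℕ} {L : List (ℕ × ℕ)} (hw : ∀ a ∈ L, a.2 ≠ w) (env : ℕ → Fin n) :
    (arcTests w L).val out env = if ∀ a ∈ L, env a.2 ∈ out (env a.1) then 1 else 0 := by
  induction L with
  | nil => simp [arcTests, val]
  | cons a L ih =>
    simp only [List.forall_mem_cons] at hw ⊢
    simp only [arcTests, val, BinOp.eval, val_arcTest hout hw.1, ih hw.2]
    split_ifs <;> simp_all

section Evaluable

variable {V : Type} {D : V → V → Prop} {ι : V → ℕ}

/-- The number of extensions to `X` is the value of an expression of depth at most `δ`. -/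
def Evaluable (D : V → V → Prop) (ι : V → ℕ) (X : Finset V) (δ : ℕ) : Prop :=
  ∃ e : Expr, e.depth ≤ δ ∧ ∀ (n : ℕ) (out : Fin n → List (Fin n)), (∀ v, (out v).Nodup) →
    ∀ env, e.val out env = (extensions out D X (env ∘ ι)).ncard

theorem Evaluable.mono {X : Finset V} {δ δ' : ℕ} (h : Evaluable D ι X δ) (hδ : δ ≤ δ') :
    Evaluable D ι X δ' := by
  obtain ⟨e, he, hv⟩ := h
  exact ⟨e, he.trans hδ, hv⟩

theorem evaluable_empty : Evaluable D ι ∅ 0 :=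
  ⟨.const 1, le_rfl, fun n out _ env => by simp [extensions_empty, Expr.val]⟩

open Classical in
/-- The vertices that are reached from `v`. -/
noncomputable def reach [Fintype V] (D : V → V → Prop) (v : V) : Finset V :=
  Finset.univ.filter (Relation.ReflTransGen D v)

theorem mem_reach [Fintype V] {v w : V} : w ∈ reach D v ↔ Relation.ReflTransGen D v w := by
  simp [reach]

variable [DecidableEq V]

/-- The two counts are computed one after the other and multiplied, so the depth does not grow. This
is what makes splitting worthwhile. -/
theorem Evaluable.union {X Y : Finset V} {δ : ℕ} (hX : Evaluable D ι X δ)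
    (hY : Evaluable D ι Y δ) (hXY : Disjoint X Y)
    (hD : ∀ a ∈ X, ∀ b ∈ Y, ¬ D a b ∧ ¬ D b a) : Evaluable D ι (X ∪ Y) δ := by
  obtain ⟨e, he, hv⟩ := hX
  obtain ⟨f, hf, hw⟩ := hY
  exact ⟨.op .mul e f, max_le he hf, fun n out ho env => by
    simp [Expr.val, BinOp.eval, hv n out ho, hw n out ho, ncard_extensions_union hXY hD]⟩

variable [Fintype V]

open Classical in
theorem exists_expr_arcs (ι : V → ℕ) (D : V → V → Prop) (X : Finset V) (v : V) :
    ∃ e : Expr, e.depth = 0 ∧ ∀ (n : ℕ) (out : Fin n → List (Fin n)), (∀ v, (out v).Nodup) →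
      ∀ env, e.val out env =
        if ∀ a b, D a b → (a = v ∨ b = v) ∧ a ∉ X.erase v ∧ b ∉ X.erase v →
          env (ι b) ∈ out (env (ι a)) then 1 else 0 := by
  -- The loop variable of the arc tests must not overwrite a variable that stands for a pattern
  -- vertex.
  obtain ⟨w, hw⟩ := Infinite.exists_notMem_finset (Finset.univ.image ι)
  let L : List (ℕ × ℕ) := ((Finset.univ.filter fun p : V × V => D p.1 p.2 ∧
    (p.1 = v ∨ p.2 = v) ∧ p.1 ∉ X.erase v ∧ p.2 ∉ X.erase v).image
      fun p => (ι p.1, ι p.2)).toList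
  refine ⟨.arcTests w L, Expr.depth_arcTests w L, fun n out ho env => ?_⟩
  rw [Expr.val_arcTests ho]
  · congr 1
    simp only [L, Finset.mem_toList, Finset.forall_mem_image, Finset.mem_filter, Finset.mem_univ,
      true_and, Prod.forall, eq_iff_iff]
    exact ⟨fun h a b h₁ h₂ => h a b ⟨h₁, h₂⟩, fun h a b h₁ => h a b h₁.1 h₁.2⟩
  · intro a ha e
    simp only [L, Finset.mem_toList, Finset.mem_image] at ha
    obtain ⟨p, -, rfl⟩ := ha
    exact hw (Finset.mem_image.mpr ⟨p.2, Finset.mem_univ _, e⟩)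

theorem Evaluable.sumAll (hι : Function.Injective ι) {X : Finset V} {v : V} {δ : ℕ} (hv : v ∈ X)
    (h : Evaluable D ι (X.erase v) δ) : Evaluable D ι X (δ + 1) := by
  classical
  obtain ⟨e, he, hval⟩ := h
  obtain ⟨f, hf, hT⟩ := exists_expr_arcs ι D X v
  refine ⟨.sumAll (ι v) (.op .mul f e), by simp [Expr.depth, hf, he], fun n out ho env => ?_⟩
  rw [ncard_extensions_eq_sum hv (List.nodup_finRange n) (by simp)]
  simp only [Expr.val, BinOp.eval, hval n out ho, hT n out ho,
    Function.update_comp_eq_of_injective _ hι]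
  simp only [← Function.comp_apply (f := Function.update env (ι v) _) (g := ι),
    Function.update_comp_eq_of_injective _ hι]

/-- Since `u` is already placed, the arc forces the image of `v` into the list of the image of `u`.
Summing over that list adds no depth. -/
theorem Evaluable.sumOut (hι : Function.Injective ι) {X : Finset V} {u v : V} {δ : ℕ}
    (hu : u ∉ X) (hv : v ∈ X) (huv : D u v) (h : Evaluable D ι (X.erase v) δ) :
    Evaluable D ι X δ := by
  classical
  obtain ⟨e, he, hval⟩ := h
  obtain ⟨f, hf, hT⟩ := exists_expr_arcs ι D X v
  refine ⟨.sumOut (ι u) (ι v) (.op .mul f e), by simp [Expr.depth, hf, he],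
    fun n out ho env => ?_⟩
  rw [ncard_extensions_eq_sum hv (ho (env (ι u)))
    (fun φ hφ => by simpa [hφ.1 u hu] using hφ.2 u v huv (Or.inr hv))]
  simp only [Expr.val, BinOp.eval, hval n out ho, hT n out ho,
    Function.update_comp_eq_of_injective _ hι]
  simp only [← Function.comp_apply (f := Function.update env (ι v) _) (g := ι),
    Function.update_comp_eq_of_injective _ hι]

/-- The vertices reached from `v` are placed one at a time, each along an arc from a vertex already
placed. -/
theorem Evaluable.of_sdiff_reach (hι : Function.Injective ι) {v : V} {δ : ℕ} (X : Finset V)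
    (hv : v ∉ X) (h : Evaluable D ι (X \ reach D v) δ) : Evaluable D ι X δ := by
  induction hk : X.card generalizing X with
  | zero =>
    obtain rfl := Finset.card_eq_zero.mp hk
    simpa using h
  | succ k ih =>
    by_cases hne : ∃ w ∈ X, Relation.ReflTransGen D v w
    · obtain ⟨w, hwX, hw⟩ := hne
      -- A path from `v`, which is outside `X`, to a vertex of `X` has an arc that enters `X`.
      obtain ⟨u, x, hu, hx, hux, hvx⟩ : ∃ u x, u ∉ X ∧ x ∈ X ∧ D u x ∧
          Relation.ReflTransGen D v x := by
        induction hw with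
        | refl => exact absurd hwX hv
        | @tail b c hb hbc ih' =>
          by_cases hbX : b ∈ X
          · exact ih' hbX
          · exact ⟨b, c, hbX, hwX, hbc, hb.tail hbc⟩
      refine Evaluable.sumOut hι hu hx hux (ih (X.erase x) (by simp [hv]) ?_ (by
        rw [Finset.card_erase_of_mem hx]; omega))
      have : X.erase x \ reach D v = X \ reach D v := by
        ext a
        simp only [Finset.mem_sdiff, Finset.mem_erase, mem_reach]
        constructor
        · tauto
        · rintro ⟨h₁, h₂⟩
          exact ⟨⟨fun h => h₂ (h ▸ hvx), h₁⟩, h₂⟩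
      rwa [this]
    · have : X \ reach D v = X := by
        ext a
        simp only [Finset.mem_sdiff, mem_reach]
        exact ⟨And.left, fun ha => ⟨ha, fun h' => hne ⟨a, ha, h'⟩⟩⟩
      rwa [this] at h

/-- Fixing the image of `v` leaves finitely many ways to map the vertices that it reaches. -/
theorem Evaluable.pick (hι : Function.Injective ι) {X : Finset V} {v : V} {δ : ℕ} (hv : v ∈ X)
    (h : Evaluable D ι (X \ reach D v) δ) : Evaluable D ι X (δ + 1) := by
  refine Evaluable.sumAll hι hv (Evaluable.of_sdiff_reach hι _ (v := v) (by simp) ?_)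
  have : X.erase v \ reach D v = X \ reach D v := by
    ext a
    simp only [Finset.mem_sdiff, Finset.mem_erase, mem_reach]
    constructor
    · tauto
    · rintro ⟨h₁, h₂⟩
      exact ⟨⟨fun h => h₂ (h ▸ Relation.ReflTransGen.refl), h₁⟩, h₂⟩
  rwa [this]

end Evaluable

/-! ### The order in which the images are fixed -/

section Sources

variable {V : Type} [Fintype V] {D : V → V → Prop} {ι : V → ℕ}

/-- An irredundant set of vertices from which all vertices are reached. -/
structure IsSourceSet (D : V → V → Prop) (S : Finset V) : Prop where
  exists_reach : ∀ v, ∃ s ∈ S, v ∈ reach D s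
  eq_of_reach : ∀ s ∈ S, ∀ t ∈ S, t ∈ reach D s → t = s

/-- No arc leads from the complement of `X` into `X`. -/
def NotEntered (D : V → V → Prop) (X : Finset V) : Prop := ∀ a b, D a b → b ∈ X → a ∈ X

theorem NotEntered.of_reach {X : Finset V} (hX : NotEntered D X) {a b : V} (h : b ∈ reach D a)
    (hb : b ∈ X) : a ∈ X := by
  have := mem_reach.mp h
  clear h
  induction this with
  | refl => exact hb
  | tail _ hbc ih => exact ih (hX _ _ hbc hb)

variable [DecidableEq V]

/-- A smallest set that reaches everything: if one member reached another, the latter could be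
dropped. -/
theorem exists_isSourceSet (D : V → V → Prop) : ∃ S, IsSourceSet D S := by
  classical
  obtain ⟨S, hS, hmin⟩ := Finset.exists_min_image
    (Finset.univ.filter fun S : Finset V => ∀ v, ∃ s ∈ S, v ∈ reach D s) Finset.card
    ⟨Finset.univ, by simpa using fun v => ⟨v, mem_reach.mpr .refl⟩⟩
  simp only [Finset.mem_filter, Finset.mem_univ, true_and] at hS hmin
  refine ⟨S, hS, fun s hs t ht hst => ?_⟩
  by_contra hne
  have h := hmin (S.erase t) fun v => by
    obtain ⟨u, hu, huv⟩ := hS v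
    by_cases hut : u = t
    · subst hut
      exact ⟨s, Finset.mem_erase.mpr ⟨fun h => hne h.symm, hs⟩,
        mem_reach.mpr ((mem_reach.mp hst).trans (mem_reach.mp huv))⟩
    · exact ⟨u, Finset.mem_erase.mpr ⟨hut, hu⟩, huv⟩
  have := Finset.card_erase_lt_of_mem ht
  omega

/-- The vertices of `X` outside `S` that are reached from `s`. -/
noncomputable def freeReach (D : V → V → Prop) (S X : Finset V) (s : V) : Finset V :=
  (X \ S) ∩ reach D s

theorem mem_freeReach {S X : Finset V} {s v : V} :
    v ∈ freeReach D S X s ↔ (v ∈ X ∧ v ∉ S) ∧ v ∈ reach D s := by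
  simp [freeReach]

theorem freeReach_mono {S X Y : Finset V} (h : X ⊆ Y) (s : V) :
    freeReach D S X s ⊆ freeReach D S Y s := by
  intro v hv
  rw [mem_freeReach] at hv ⊢
  exact ⟨⟨h hv.1.1, hv.1.2⟩, hv.2⟩

theorem NotEntered.sdiff_reach {X : Finset V} (hX : NotEntered D X) (s : V) :
    NotEntered D (X \ reach D s) := by
  intro a b hab hb
  rw [Finset.mem_sdiff] at hb ⊢
  exact ⟨hX a b hab hb.1, fun h => hb.2 (mem_reach.mpr ((mem_reach.mp h).tail hab))⟩

/-! ### The base case of depth two -/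

variable {S : Finset V}

/-- Distinct sources are not joined by arcs, so they are guessed independently and a single level of
summation suffices. -/
theorem evaluable_of_subset_sources (hι : Function.Injective ι) (hS : IsSourceSet D S)
    {X : Finset V} (hX : X ⊆ S) : Evaluable D ι X 1 := by
  induction X using Finset.induction_on with
  | empty => exact evaluable_empty.mono (by omega)
  | insert s X hs ih =>
    rw [Finset.insert_subset_iff] at hX
    rw [Finset.insert_eq]
    refine Evaluable.union ?_ (ih hX.2) (by simpa using hs) ?_
    · refine Evaluable.pick hι (v := s) (by simp) ?_
      have : ({s} : Finset V) \ reach D s = ∅ := by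
        simp [Finset.sdiff_eq_empty_iff_subset, mem_reach, Relation.ReflTransGen.refl]
      rw [this]
      exact evaluable_empty
    · intro a ha b hb
      rw [Finset.mem_singleton] at ha
      subst ha
      have hne : b ≠ a := fun h => hs (h ▸ hb)
      exact ⟨fun h => hne (hS.eq_of_reach _ hX.1 _ (hX.2 hb) (mem_reach.mpr (.single h))),
        fun h => hne (hS.eq_of_reach _ (hX.2 hb) _ hX.1 (mem_reach.mpr (.single h))).symm⟩

/-- Take a source `c` with most free vertices. Every source sharing a free vertex with `c` has no
free vertices besides those of `c`. These sources and the free vertices of `c` form a part `C` with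
no arcs to or from the rest of `X`. Guessing `c` places all free vertices of `C` and leaves only
sources; the rest of `X` is treated by induction. -/
theorem evaluable_of_disjoint (hι : Function.Injective ι) (hS : IsSourceSet D S)
    (X : Finset V) (hX : NotEntered D X) (h₂ : ∀ s ∈ S, (freeReach D S X s).card ≤ 2)
    (hdisj : ∀ s ∈ S, ∀ t ∈ S, s ≠ t → (freeReach D S X s).card = 2 →
      (freeReach D S X t).card = 2 → Disjoint (freeReach D S X s) (freeReach D S X t)) :
    Evaluable D ι X 2 := by
  classical
  induction hk : X.card using Nat.strong_induction_on generalizing X with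
  | _ k ih =>
  rcases X.eq_empty_or_nonempty with rfl | ⟨x, hx⟩
  · exact evaluable_empty.mono (by omega)
  obtain ⟨c, hc, hmax⟩ := Finset.exists_max_image (S ∩ X) (fun s => (freeReach D S X s).card) (by
    obtain ⟨s, hs, hsx⟩ := hS.exists_reach x
    exact ⟨s, Finset.mem_inter.mpr ⟨hs, hX.of_reach hsx hx⟩⟩)
  rw [Finset.mem_inter] at hc
  let K := (S ∩ X).filter fun s => s = c ∨ ¬ Disjoint (freeReach D S X s) (freeReach D S X c)
  let C := K ∪ freeReach D S X c
  have hcK : c ∈ K := by simp [K, hc.1, hc.2]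
  have hKS : ∀ s ∈ K, s ∈ S ∧ s ∈ X := fun s hs =>
    Finset.mem_inter.mp (Finset.mem_filter.mp hs).1
  have hsub : ∀ s ∈ K, freeReach D S X s ⊆ freeReach D S X c := by
    intro s hs
    by_cases hsc : s = c
    · rw [hsc]
    have hnd := ((Finset.mem_filter.mp hs).2).resolve_left hsc
    have h₁ := hmax s (Finset.mem_filter.mp hs).1
    have h₃ := h₂ c hc.1
    -- If `s` had two free vertices, so would `c` by maximality, and the two pairs would be disjoint
    -- by hypothesis.
    have h₄ : (freeReach D S X s).card ≤ 1 := by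
      by_contra hgt
      exact hnd (hdisj s (hKS s hs).1 c hc.1 hsc (by omega) (by omega))
    obtain ⟨y, hys, hyc⟩ := Finset.not_disjoint_iff.mp hnd
    intro z hz
    rwa [Finset.card_le_one.mp h₄ z hz y hys]
  have hCX : C ⊆ X := by
    intro a ha
    rcases Finset.mem_union.mp ha with ha | ha
    · exact (hKS a ha).2
    · exact (mem_freeReach.mp ha).1.1
  have hout : ∀ s ∈ K, ∀ b ∈ X, b ∈ reach D s → b ∈ C := by
    intro s hs b hb hsb
    by_cases hbS : b ∈ S
    · rw [hS.eq_of_reach s (hKS s hs).1 b hbS hsb]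
      exact Finset.mem_union_left _ hs
    · exact Finset.mem_union_right _ (hsub s hs (mem_freeReach.mpr ⟨⟨hb, hbS⟩, hsb⟩))
  have hforward : ∀ a ∈ C, ∀ b ∈ X, D a b → b ∈ C := by
    intro a ha b hb hab
    rcases Finset.mem_union.mp ha with ha | ha
    · exact hout a ha b hb (mem_reach.mpr (.single hab))
    · exact hout c hcK b hb (mem_reach.mpr ((mem_reach.mp (mem_freeReach.mp ha).2).tail hab))
  -- A source of `a` also reaches `b`. Either it equals the source `b`, or it shares the free vertex
  -- `b` with `c`; in both cases it is in `K`.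
  have hbackward : ∀ b ∈ C, ∀ a ∈ X, D a b → a ∈ C := by
    intro b hb a ha hab
    obtain ⟨s, hs, hsa⟩ := hS.exists_reach a
    have hsb : b ∈ reach D s := mem_reach.mpr ((mem_reach.mp hsa).tail hab)
    have hsX : s ∈ X := hX.of_reach hsa ha
    refine hout s ?_ a ha hsa
    rcases Finset.mem_union.mp hb with hb | hb
    · rwa [← hS.eq_of_reach s hs b (hKS b hb).1 hsb]
    · refine Finset.mem_filter.mpr ⟨Finset.mem_inter.mpr ⟨hs, hsX⟩, Or.inr ?_⟩
      exact Finset.not_disjoint_iff.mpr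
        ⟨b, mem_freeReach.mpr ⟨(mem_freeReach.mp hb).1, hsb⟩, hb⟩
  have hEC : Evaluable D ι C 2 := by
    refine Evaluable.pick hι (Finset.mem_union_left _ hcK)
      (evaluable_of_subset_sources hι hS fun a ha => ?_)
    obtain ⟨ha, hca⟩ := Finset.mem_sdiff.mp ha
    rcases Finset.mem_union.mp ha with ha | ha
    · exact (hKS a ha).1
    · exact absurd (mem_freeReach.mp ha).2 hca
  have hmono : ∀ s, freeReach D S (X \ C) s ⊆ freeReach D S X s :=
    freeReach_mono Finset.sdiff_subset
  -- A source that still has two free vertices after the removal of `C` has lost none, so the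
  -- disjointness hypothesis carries over.
  have hcard : ∀ s ∈ S, (freeReach D S (X \ C) s).card = 2 →
      freeReach D S (X \ C) s = freeReach D S X s := fun s hs h =>
    Finset.eq_of_subset_of_card_le (hmono s) (by rw [h]; exact h₂ s hs)
  have hEX : Evaluable D ι (X \ C) 2 := by
    refine ih (X \ C).card ?_ (X \ C) ?_ ?_ ?_ rfl
    · rw [← hk]
      exact Finset.card_lt_card (Finset.sdiff_ssubset hCX ⟨c, Finset.mem_union_left _ hcK⟩)
    · intro a b hab hb
      rw [Finset.mem_sdiff] at hb ⊢
      have ha := hX a b hab hb.1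
      exact ⟨ha, fun haC => hb.2 (hforward a haC b hb.1 hab)⟩
    · exact fun s hs => (Finset.card_le_card (hmono s)).trans (h₂ s hs)
    · intro s hs t ht hne h h'
      rw [hcard s hs h, hcard t ht h'] at *
      exact hdisj s hs t ht hne h h'
  have := hEC.union hEX Finset.disjoint_sdiff fun a ha b hb => by
    rw [Finset.mem_sdiff] at hb
    exact ⟨fun h => hb.2 (hforward a ha b hb.1 h), fun h => hb.2 (hbackward a ha b hb.1 h)⟩
  rwa [Finset.union_sdiff_of_subset hCX] at this

/-! ### The potential argument -/

/-- The vertices of `X` outside `S` and the sources that reach at least two of them, counted. -/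
noncomputable def potential (D : V → V → Prop) (S X : Finset V) : ℕ :=
  (X \ S).card + (S.filter fun s => 2 ≤ (freeReach D S X s).card).card

theorem card_sdiff_reach (X : Finset V) (s : V) :
    ((X \ reach D s) \ S).card + (freeReach D S X s).card = (X \ S).card := by
  rw [freeReach, sdiff_right_comm]
  exact Finset.card_sdiff_add_card_inter _ _

theorem freeReach_sdiff_reach (X : Finset V) (s t : V) :
    freeReach D S (X \ reach D s) t = freeReach D S X t \ reach D s := by
  ext v
  simp only [mem_freeReach, Finset.mem_sdiff]
  tauto

/-- Each guess that lowers the potential by at least 4 is paid for by one unit of its quarter. If no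
such guess is available, the hypotheses of `evaluable_of_disjoint` hold. -/
theorem evaluable_of_notEntered (hι : Function.Injective ι) (hS : IsSourceSet D S)
    (X : Finset V) (hX : NotEntered D X) : Evaluable D ι X (potential D S X / 4 + 2) := by
  classical
  induction hk : X.card using Nat.strong_induction_on generalizing X with
  | _ k ih =>
  let rich (X : Finset V) := S.filter fun s => 2 ≤ (freeReach D S X s).card
  have hpick : ∀ s, (freeReach D S X s).Nonempty →
      potential D S (X \ reach D s) + 4 ≤ potential D S X →
      Evaluable D ι X (potential D S X / 4 + 2) := by
    rintro s ⟨v, hv⟩ hpot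
    rw [mem_freeReach] at hv
    have hs : s ∈ X := hX.of_reach hv.2 hv.1.1
    have hlt : (X \ reach D s).card < k := hk ▸ Finset.card_lt_card
      ⟨Finset.sdiff_subset, fun h => (Finset.mem_sdiff.mp (h hs)).2 (mem_reach.mpr .refl)⟩
    exact (Evaluable.pick hι hs (ih _ hlt _ (hX.sdiff_reach s) rfl)).mono (by omega)
  -- After the guess of `s` nothing free is left for `s` itself, and no other source gains free
  -- vertices.
  have hrich : ∀ s, rich (X \ reach D s) ⊆ (rich X).erase s := by
    intro s t ht
    simp only [rich, Finset.mem_filter, Finset.mem_erase] at ht ⊢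
    refine ⟨?_, ht.1, ht.2.trans (Finset.card_le_card (freeReach_mono Finset.sdiff_subset t))⟩
    rintro rfl
    have : freeReach D S (X \ reach D t) t = ∅ := by
      rw [freeReach_sdiff_reach, Finset.sdiff_eq_empty_iff_subset, freeReach]
      exact Finset.inter_subset_right
    simp [this] at ht
  have hmem : ∀ s ∈ S, 2 ≤ (freeReach D S X s).card → s ∈ rich X := fun s hs h => by
    simp [rich, hs, h]
  by_cases h₃ : ∃ s ∈ S, 3 ≤ (freeReach D S X s).card
  · obtain ⟨s, hs, h⟩ := h₃
    -- At least three free vertices disappear, and `s` is no longer rich.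
    refine hpick s (Finset.card_pos.mp (by omega)) ?_
    have h₁ := card_sdiff_reach (D := D) (S := S) X s
    have h₂ := Finset.card_le_card (hrich s)
    have h₄ := Finset.card_erase_lt_of_mem (hmem s hs (by omega))
    simp only [potential]
    simp only [rich] at h₂ h₄
    omega
  by_cases h₂ : ∃ s ∈ S, ∃ t ∈ S, s ≠ t ∧ (freeReach D S X s).card = 2 ∧
      (freeReach D S X t).card = 2 ∧ ¬ Disjoint (freeReach D S X s) (freeReach D S X t)
  · obtain ⟨s, hs, t, ht, hne, hs₂, ht₂, hnd⟩ := h₂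
    refine hpick s (Finset.card_pos.mp (by omega)) ?_
    have h₁ := card_sdiff_reach (D := D) (S := S) X s
    -- Two free vertices disappear, and two sources cease to be rich: `s`, and `t`, which loses a
    -- shared vertex and keeps at most one.
    have h₄ : rich (X \ reach D s) ⊆ ((rich X).erase s).erase t := by
      intro u hu
      refine Finset.mem_erase.mpr ⟨?_, hrich s hu⟩
      rintro rfl
      obtain ⟨y, hys, hyt⟩ := Finset.not_disjoint_iff.mp hnd
      have hlt : (freeReach D S (X \ reach D s) u).card < (freeReach D S X u).card := by
        rw [freeReach_sdiff_reach]
        exact Finset.card_lt_card ⟨Finset.sdiff_subset, fun h =>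
          (Finset.mem_sdiff.mp (h hyt)).2 (mem_freeReach.mp hys).2⟩
      have := (Finset.mem_filter.mp hu).2
      omega
    have h₅ := Finset.card_le_card h₄
    have h₆ := Finset.card_erase_lt_of_mem (hmem s hs (by omega))
    have h₇ := Finset.card_erase_lt_of_mem
      (Finset.mem_erase.mpr ⟨hne.symm, hmem t ht (by omega)⟩)
    simp only [potential]
    simp only [rich] at h₅ h₆ h₇
    omega
  · push Not at h₃ h₂
    exact (evaluable_of_disjoint hι hS X hX (fun s hs => by have := h₃ s hs; omega) h₂).mono
      (by omega)

/-- The two terms of the potential count vertices outside and inside `S`, so it is at most the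
number of vertices. -/
theorem evaluable_univ (hι : Function.Injective ι) (D : V → V → Prop) :
    Evaluable D ι Finset.univ (Fintype.card V / 4 + 2) := by
  obtain ⟨S, hS⟩ := exists_isSourceSet D
  refine (evaluable_of_notEntered hι hS _ fun a b _ _ => Finset.mem_univ a).mono ?_
  have h₁ : potential D S Finset.univ ≤ (Finset.univ \ S).card + S.card :=
    Nat.add_le_add_left (Finset.card_filter_le _ _) _
  rw [Finset.card_sdiff_add_card_eq_card (Finset.subset_univ S), Finset.card_univ] at h₁
  omega

end Sources

/-! ### Constraints on maps into a host -/

/-- A condition on a map from `V` into a host. -/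
inductive Constraint (V : Type) where
  /-- the images of `u` and `v` are adjacent -/
  | adj (u v : V)
  /-- the images of `u` and `v` are not adjacent -/
  | nonadj (u v : V)
  /-- the images of `u` and `v` are different -/
  | ne (u v : V)

namespace Constraint

/-- The map `φ` satisfies the constraint. -/
def Holds {V : Type} {n : ℕ} (G : SimpleGraph (Fin n)) (φ : V → Fin n) : Constraint V → Prop
  | adj u v => G.Adj (φ u) (φ v)
  | nonadj u v => ¬ G.Adj (φ u) (φ v)
  | ne u v => φ u ≠ φ v

/-- The constraint on maps from `W` that `q : V → W` turns into a constraint on maps from `V`. -/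
def map {V W : Type} (q : V → W) : Constraint V → Constraint W
  | adj u v => adj (q u) (q v)
  | nonadj u v => nonadj (q u) (q v)
  | ne u v => ne (q u) (q v)

theorem holds_map {V W : Type} {n : ℕ} (G : SimpleGraph (Fin n)) (q : V → W) (φ : W → Fin n)
    (c : Constraint V) : (c.map q).Holds G φ ↔ c.Holds G (φ ∘ q) := by
  cases c <;> rfl

end Constraint

section ConstrainedMaps

variable {V : Type} {n d : ℕ} {G : SimpleGraph (Fin n)}

/-- The maps that send arcs of `D` to pairs in the lists of `A` and satisfy all of `L`. -/
def constrainedMaps (A : Presentation G d) (D : V → V → Prop) (L : List (Constraint V)) :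
    Set (V → Fin n) :=
  {φ | (∀ a b, D a b → φ b ∈ A.out (φ a)) ∧ ∀ c ∈ L, c.Holds G φ}

/-- The relation `D` with the additional arc from `u` to `v`. -/
def addArc (D : V → V → Prop) (u v : V) (a b : V) : Prop := D a b ∨ a = u ∧ b = v

theorem mem_constrainedMaps_addArc {A : Presentation G d} {D : V → V → Prop}
    {L : List (Constraint V)} {u v : V} {φ : V → Fin n} :
    φ ∈ constrainedMaps A (addArc D u v) L ↔
      φ ∈ constrainedMaps A D L ∧ φ v ∈ A.out (φ u) := by
  simp only [constrainedMaps, addArc, Set.mem_ofPred_eq]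
  constructor
  · rintro ⟨h₁, h₂⟩
    exact ⟨⟨fun a b h => h₁ a b (Or.inl h), h₂⟩, h₁ u v (Or.inr ⟨rfl, rfl⟩)⟩
  · rintro ⟨⟨h₁, h₂⟩, h₃⟩
    refine ⟨fun a b h => ?_, h₂⟩
    rcases h with h | ⟨rfl, rfl⟩
    · exact h₁ a b h
    · exact h₃

theorem mem_constrainedMaps_cons {A : Presentation G d} {D : V → V → Prop}
    {L : List (Constraint V)} {c : Constraint V} {φ : V → Fin n} :
    φ ∈ constrainedMaps A D (c :: L) ↔ φ ∈ constrainedMaps A D L ∧ c.Holds G φ := by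
  simp only [constrainedMaps, Set.mem_ofPred_eq, List.forall_mem_cons]
  tauto

theorem Presentation.adj_iff (A : Presentation G d) (x y : Fin n) :
    G.Adj x y ↔ y ∈ A.out x ∨ x ∈ A.out y := by
  rw [A.mem_out, A.mem_out]
  constructor
  · intro h
    rcases lt_trichotomy (A.rank x) (A.rank y) with hlt | heq | hgt
    · exact Or.inl ⟨h, hlt⟩
    · exact absurd (A.rank_injective heq) h.ne
    · exact Or.inr ⟨h.symm, hgt⟩
  · rintro (⟨h, -⟩ | ⟨h, -⟩)
    exacts [h, h.symm]

variable [Finite V]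

/-- An edge of the host lies in exactly one of the lists of its ends, because the ranks of the ends
differ. -/
theorem ncard_constrainedMaps_adj (A : Presentation G d) (D : V → V → Prop)
    (L : List (Constraint V)) (u v : V) :
    (constrainedMaps A D (.adj u v :: L)).ncard =
      (constrainedMaps A (addArc D u v) L).ncard +
        (constrainedMaps A (addArc D v u) L).ncard := by
  rw [← Set.ncard_union_eq]
  · congr 1
    ext φ
    rw [Set.mem_union, mem_constrainedMaps_cons, mem_constrainedMaps_addArc,
      mem_constrainedMaps_addArc, Constraint.Holds, A.adj_iff, and_or_left]
  · rw [Set.disjoint_left]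
    intro φ h₁ h₂
    have h₃ := ((A.mem_out _ _).mp (mem_constrainedMaps_addArc.mp h₁).2).2
    have h₄ := ((A.mem_out _ _).mp (mem_constrainedMaps_addArc.mp h₂).2).2
    omega

theorem ncard_constrainedMaps_nonadj (A : Presentation G d) (D : V → V → Prop)
    (L : List (Constraint V)) (u v : V) :
    (constrainedMaps A D (.nonadj u v :: L)).ncard =
      (constrainedMaps A D L).ncard - (constrainedMaps A D (.adj u v :: L)).ncard := by
  rw [← Set.ncard_sdiff]
  · congr 1
    ext φ
    rw [Set.mem_sdiff, mem_constrainedMaps_cons, mem_constrainedMaps_cons]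
    simp only [Constraint.Holds]
    tauto
  · exact fun φ hφ => (mem_constrainedMaps_cons.mp hφ).1

open Classical in
/-- The map that moves `v` to `u` and fixes all other elements. -/
noncomputable def contract {u v : V} (huv : u ≠ v) (x : V) : {x : V // x ≠ v} :=
  if h : x = v then ⟨u, huv⟩ else ⟨x, h⟩

/-- The maps with equal values at `u` and `v` are exactly those that factor through the contraction,
and the factorisation is unique because the contraction is surjective. They form a subset, so the
truncated subtraction is exact. -/
theorem ncard_constrainedMaps_ne (A : Presentation G d) (D : V → V → Prop)
    (L : List (Constraint V)) {u v : V} (huv : u ≠ v) :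
    (constrainedMaps A D (.ne u v :: L)).ncard =
      (constrainedMaps A D L).ncard -
        (constrainedMaps A (Relation.Map D (contract huv) (contract huv))
          (L.map (Constraint.map (contract huv)))).ncard := by
  have hq : ∀ x : {x : V // x ≠ v}, contract huv x = x := fun x => by simp [contract, x.2]
  have hinj : Function.Injective fun φ : {x : V // x ≠ v} → Fin n => φ ∘ contract huv :=
    Function.Surjective.injective_comp_right fun x => ⟨x, hq x⟩
  rw [← Set.ncard_image_of_injective _ hinj, ← Set.ncard_sdiff]
  · congr 1
    ext φ
    rw [mem_constrainedMaps_cons, Set.mem_sdiff]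
    refine and_congr_right fun hφ => not_congr ⟨fun h => ?_, ?_⟩
    · have hc : (fun x : {x : V // x ≠ v} => φ x) ∘ contract huv = φ := by
        funext x
        by_cases hx : x = v
        · subst hx; simpa [contract] using h
        · simp [contract, hx]
      refine ⟨fun x => φ x, ⟨?_, ?_⟩, hc⟩
      · rintro _ _ ⟨a, b, hab, rfl, rfl⟩
        have := hφ.1 a b hab
        rwa [← hc] at this
      · simp only [List.mem_map]
        rintro _ ⟨c, hcL, rfl⟩
        rw [Constraint.holds_map, hc]
        exact hφ.2 c hcL
    · rintro ⟨ψ, -, rfl⟩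
      simp [contract, huv]
  · rintro _ ⟨ψ, ⟨h₁, h₂⟩, rfl⟩
    refine ⟨fun a b hab => h₁ _ _ ⟨a, b, hab, rfl, rfl⟩, fun c hc => ?_⟩
    rw [← Constraint.holds_map]
    exact h₂ _ (List.mem_map_of_mem hc)

end ConstrainedMaps

/-- Constraints are eliminated one by one. `V` and `D` vary in the induction, since orientations add
arcs and contractions remove a vertex; fewer vertices never increase the depth bound. -/
theorem exists_expr_constrainedMaps (m : ℕ) : ∀ (V : Type) [Fintype V] (D : V → V → Prop)
    (L : List (Constraint V)), L.length = m → ∃ e : Expr, e.depth ≤ Fintype.card V / 4 + 2 ∧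
      ∀ (d n : ℕ) (G : SimpleGraph (Fin n)) (A : Presentation G d) (env : ℕ → Fin n),
        e.val A.out env = (constrainedMaps A D L).ncard := by
  classical
  induction m with
  | zero =>
    intro V _ D L hL
    obtain rfl := List.length_eq_zero_iff.mp hL
    have hι : Function.Injective fun v : V => (Fintype.equivFin V v : ℕ) :=
      Fin.val_injective.comp (Fintype.equivFin V).injective
    obtain ⟨e, he, hv⟩ := evaluable_univ hι D
    refine ⟨e, he, fun d n G A env => ?_⟩
    rw [hv n A.out A.nodup_out]
    congr 1
    ext φ
    simp [extensions, constrainedMaps]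
  | succ m ih =>
    intro V _ D L hL
    obtain _ | ⟨c, L⟩ := L
    · simp at hL
    have hL : L.length = m := by simpa using hL
    have hadj : ∀ u v, ∃ e : Expr, e.depth ≤ Fintype.card V / 4 + 2 ∧
        ∀ (d n : ℕ) (G : SimpleGraph (Fin n)) (A : Presentation G d) (env : ℕ → Fin n),
          e.val A.out env = (constrainedMaps A D (.adj u v :: L)).ncard := by
      intro u v
      obtain ⟨e, he, hev⟩ := ih V (addArc D u v) L hL
      obtain ⟨f, hf, hfv⟩ := ih V (addArc D v u) L hL
      refine ⟨.op .add e f, max_le he hf, fun d n G A env => ?_⟩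
      rw [ncard_constrainedMaps_adj, ← hev d n G A env, ← hfv d n G A env]
      rfl
    obtain ⟨e, he, hev⟩ := ih V D L hL
    cases c with
    | adj u v => exact hadj u v
    | nonadj u v =>
      obtain ⟨f, hf, hfv⟩ := hadj u v
      refine ⟨.op .sub e f, max_le he hf, fun d n G A env => ?_⟩
      rw [ncard_constrainedMaps_nonadj, ← hev d n G A env, ← hfv d n G A env]
      rfl
    | ne u v =>
      by_cases huv : u = v
      · refine ⟨.const 0, Nat.zero_le _, fun d n G A env => ?_⟩
        have : constrainedMaps A D (.ne u v :: L) = ∅ :=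
          Set.eq_empty_iff_forall_notMem.mpr fun φ hφ =>
            (mem_constrainedMaps_cons.mp hφ).2 (congrArg φ huv)
        simp [this, Expr.val]
      · obtain ⟨f, hf, hfv⟩ := ih {x : V // x ≠ v}
          (Relation.Map D (contract huv) (contract huv))
          (L.map (Constraint.map (contract huv))) (by simpa using hL)
        have hcard := Fintype.card_subtype_le fun x : V => x ≠ v
        refine ⟨.op .sub e f, max_le he (hf.trans (by gcongr)), fun d n G A env => ?_⟩
        rw [ncard_constrainedMaps_ne A D L huv, ← hev d n G A env, ← hfv d n G A env]
        rfl

/-! ### Homomorphisms, subgraphs and induced subgraphs -/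

section Automorphisms

variable {k n : ℕ} (H : SimpleGraph (Fin k)) (G : SimpleGraph (Fin n))

theorem card_iso_eq_card_aut {W : Type*} {H : SimpleGraph (Fin k)} {K : SimpleGraph W}
    (h : Nonempty (H ≃g K)) : Nat.card (H ≃g K) = Nat.card (H ≃g H) := by
  obtain ⟨e⟩ := h
  exact Nat.card_congr
    { toFun := fun f => f.trans e.symm
      invFun := fun f => f.trans e
      left_inv := fun f => by ext; simp
      right_inv := fun f => by ext; simp }

theorem card_aut_pos : 0 < Nat.card (H ≃g H) :=
  have : Finite (H ≃g H) := DFunLike.finite _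
  have : Nonempty (H ≃g H) := ⟨.refl⟩
  Nat.card_pos

/-- An injective homomorphism amounts to its image subgraph together with an isomorphism of `H` onto
it, and there are as many of these as automorphisms of `H`. -/
theorem card_copy_eq_sub_mul :
    Nat.card (SimpleGraph.Copy H G) = sub H G * Nat.card (H ≃g H) := by
  classical
  have (G' : G.Subgraph) : Finite (H ≃g G'.coe) := DFunLike.finite _
  let F : (Σ G' : {G' : G.Subgraph // Nonempty (H ≃g G'.coe)}, H ≃g G'.1.coe) →
      SimpleGraph.Copy H G :=
    fun p => ⟨p.1.1.hom.comp p.2.toHom, p.1.1.hom_injective.comp p.2.injective⟩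
  have hF : ∀ p, (F p).toSubgraph = p.1.1 := fun p => by
    simp [F, SimpleGraph.Copy.toSubgraph, SimpleGraph.Subgraph.map_comp]
  have hbij : Function.Bijective F := by
    constructor
    · rintro ⟨⟨G₁, h₁⟩, e₁⟩ ⟨⟨G₂, h₂⟩, e₂⟩ h
      obtain rfl : G₁ = G₂ :=
        (hF ⟨⟨G₁, h₁⟩, e₁⟩).symm.trans ((congrArg _ h).trans (hF ⟨⟨G₂, h₂⟩, e₂⟩))
      congr 1
      exact RelIso.ext fun v => Subtype.ext (DFunLike.congr_fun h v)
    · intro f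
      refine ⟨⟨⟨f.toSubgraph, ⟨f.isoToSubgraph⟩⟩, f.isoToSubgraph⟩, ?_⟩
      ext v
      rfl
  rw [← Nat.card_congr (Equiv.ofBijective F hbij), Nat.card_sigma,
    Finset.sum_congr rfl fun G' _ => card_iso_eq_card_aut G'.2, Finset.sum_const, smul_eq_mul,
    Finset.card_univ, sub, SimpleGraph.copyCount, Fintype.card_subtype]
  congr!

/-- As for copies, with the vertex set of the image in place of the image subgraph. -/
theorem card_embedding_eq_ind_mul :
    Nat.card (H ↪g G) = ind H G * Nat.card (H ≃g H) := by
  classical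
  have (S : Set (Fin n)) : Finite (H ≃g G.induce S) := DFunLike.finite _
  let F : (Σ S : {S : Set (Fin n) // Nonempty (H ≃g G.induce S)}, H ≃g G.induce S.1) →
      (H ↪g G) := fun p => (SimpleGraph.Embedding.induce p.1.1).comp p.2.toEmbedding
  have hF : ∀ p, Set.range (F p) = p.1.1 := fun p => by
    ext x
    constructor
    · rintro ⟨v, rfl⟩
      exact (p.2 v).2
    · intro hx
      exact ⟨p.2.symm ⟨x, hx⟩, by simp [F]⟩
  have hbij : Function.Bijective F := by
    constructor
    · rintro ⟨⟨S₁, h₁⟩, e₁⟩ ⟨⟨S₂, h₂⟩, e₂⟩ h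
      obtain rfl : S₁ = S₂ :=
        (hF ⟨⟨S₁, h₁⟩, e₁⟩).symm.trans
          ((congrArg (fun f : H ↪g G => Set.range f) h).trans (hF ⟨⟨S₂, h₂⟩, e₂⟩))
      congr 1
      exact RelIso.ext fun v => Subtype.ext (DFunLike.congr_fun h v)
    · intro f
      let e : H ≃g G.induce (Set.range f) :=
        ⟨Equiv.ofInjective f f.injective, by simp⟩
      exact ⟨⟨⟨_, ⟨e⟩⟩, e⟩, by ext v; rfl⟩
  rw [← Nat.card_congr (Equiv.ofBijective F hbij), Nat.card_sigma,
    Finset.sum_congr rfl fun S _ => card_iso_eq_card_aut S.2, Finset.sum_const, smul_eq_mul,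
    Finset.card_univ, ind, ← Nat.card_eq_fintype_card]

end Automorphisms

section Patterns

variable {k : ℕ} (H : SimpleGraph (Fin k))

open Classical in
/-- The constraints that edges are mapped to edges. -/
noncomputable def edgeConstraints : List (Constraint (Fin k)) :=
  (Finset.univ.filter fun p : Fin k × Fin k => H.Adj p.1 p.2).toList.map fun p => .adj p.1 p.2

/-- The constraints that different vertices have different images. -/
noncomputable def neConstraints (k : ℕ) : List (Constraint (Fin k)) :=
  (Finset.univ.filter fun p : Fin k × Fin k => p.1 ≠ p.2).toList.map fun p => .ne p.1 p.2

open Classical in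
/-- The constraints that vertices without an edge are mapped to vertices without an edge. -/
noncomputable def nonedgeConstraints : List (Constraint (Fin k)) :=
  (Finset.univ.filter fun p : Fin k × Fin k => ¬ H.Adj p.1 p.2).toList.map
    fun p => .nonadj p.1 p.2

variable {n d : ℕ} {G : SimpleGraph (Fin n)} (φ : Fin k → Fin n)

theorem holds_edgeConstraints :
    (∀ c ∈ edgeConstraints H, c.Holds G φ) ↔ ∀ u v, H.Adj u v → G.Adj (φ u) (φ v) := by
  simp only [edgeConstraints, List.forall_mem_map, Finset.mem_toList, Finset.mem_filter,
    Finset.mem_univ, true_and, Prod.forall, Constraint.Holds]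

theorem holds_neConstraints :
    (∀ c ∈ neConstraints k, c.Holds G φ) ↔ Function.Injective φ := by
  simp only [neConstraints, List.forall_mem_map, Finset.mem_toList, Finset.mem_filter,
    Finset.mem_univ, true_and, Prod.forall, Constraint.Holds]
  exact ⟨fun h u v e => by_contra fun hne => h u v hne e, fun h u v hne e => hne (h e)⟩

theorem holds_nonedgeConstraints :
    (∀ c ∈ nonedgeConstraints H, c.Holds G φ) ↔ ∀ u v, ¬ H.Adj u v → ¬ G.Adj (φ u) (φ v) := by
  simp only [nonedgeConstraints, List.forall_mem_map, Finset.mem_toList, Finset.mem_filter,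
    Finset.mem_univ, true_and, Prod.forall, Constraint.Holds]

theorem ncard_constrainedMaps_hom (A : Presentation G d) :
    (constrainedMaps A (fun _ _ => False) (edgeConstraints H)).ncard = hom H G := by
  rw [hom, ← Nat.card_coe_set_eq]
  refine Nat.card_congr
    { toFun := fun φ => ⟨φ.1, fun {u v} h => (holds_edgeConstraints H φ.1).mp φ.2.2 u v h⟩
      invFun := fun f => ⟨f, by simp,
        (holds_edgeConstraints H f).mpr fun u v h => f.map_rel h⟩
      left_inv := fun φ => rfl
      right_inv := fun f => rfl }

theorem ncard_constrainedMaps_copy (A : Presentation G d) :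
    (constrainedMaps A (fun _ _ => False) (edgeConstraints H ++ neConstraints k)).ncard =
      sub H G * Nat.card (H ≃g H) := by
  rw [← card_copy_eq_sub_mul, ← Nat.card_coe_set_eq]
  simp only [constrainedMaps, List.forall_mem_append, holds_edgeConstraints, holds_neConstraints]
  refine Nat.card_congr
    { toFun := fun φ => ⟨⟨φ.1, fun {u v} h => φ.2.2.1 u v h⟩, φ.2.2.2⟩
      invFun := fun f => ⟨f, by simp, fun u v h => f.toHom.map_rel h, f.injective⟩
      left_inv := fun φ => rfl
      right_inv := fun f => rfl }

theorem ncard_constrainedMaps_embedding (A : Presentation G d) :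
    (constrainedMaps A (fun _ _ => False)
      (edgeConstraints H ++ neConstraints k ++ nonedgeConstraints H)).ncard =
      ind H G * Nat.card (H ≃g H) := by
  rw [← card_embedding_eq_ind_mul, ← Nat.card_coe_set_eq]
  simp only [constrainedMaps, List.forall_mem_append, holds_edgeConstraints, holds_neConstraints,
    holds_nonedgeConstraints]
  refine Nat.card_congr
    { toFun := fun φ => ⟨⟨φ.1, φ.2.2.1.2⟩, fun {u v} =>
        ⟨fun h => by_contra fun h' => φ.2.2.2 u v h' h, φ.2.2.1.1 u v⟩⟩
      invFun := fun f => ⟨f, by simp, ⟨fun u v h => f.map_rel_iff.mpr h, f.injective⟩,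
        fun u v h h' => h (f.map_rel_iff.mp h')⟩
      left_inv := fun φ => rfl
      right_inv := fun f => rfl }

end Patterns

/-- The quantity `Q`, which depends on a host, is computed by a program in time
`O(n ^ (⌊k / 4⌋ + 2))` and constant space. -/
theorem exists_program_constrainedMaps_div {k : ℕ} (L : List (Constraint (Fin k))) {c : ℕ}
    (hc : 0 < c) (Q : ∀ n, SimpleGraph (Fin n) → ℕ)
    (hQ : ∀ (d n : ℕ) (G : SimpleGraph (Fin n)) (A : Presentation G d),
      (constrainedMaps A (fun _ _ => False) L).ncard = Q n G * c) :
    ∃ (P : Program) (f s : ℕ → ℕ), ∀ d n, 1 ≤ n → ∀ G : SimpleGraph (Fin n),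
      ∀ A : Presentation G d, ComputesWithin P A.out (Q n G) (f d * n ^ (k / 4 + 2)) (s d)
        (s d * n ^ s d) := by
  obtain ⟨e, he, hev⟩ := exists_expr_constrainedMaps _ (Fin k) (fun _ _ => False) L rfl
  obtain ⟨P, f, s, h⟩ := (Expr.op .div e (.const c)).exists_program
  refine ⟨P, f, s, fun d n hn G A => ?_⟩
  have := h d n hn A.out A.length_out_le
  rw [show (Expr.op .div e (.const c)).val A.out (fun _ => ⟨0, hn⟩) = Q n G by
    simp [Expr.val, BinOp.eval, hev d n G A, hQ d n G A, hc]] at this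
  refine this.mono (Nat.mul_le_mul_left _ (Nat.pow_le_pow_right hn ?_)) le_rfl le_rfl
  simpa [Expr.depth] using he

theorem exists_programs {k : ℕ} (H : SimpleGraph (Fin k)) :
    ∃ f s : ℕ → ℕ, ∃ Phom Psub Pind : Program, ∀ d n, 1 ≤ n → ∀ G : SimpleGraph (Fin n),
      ∀ A : Presentation G d,
        ComputesWithin Phom A.out (hom H G) (f d * n ^ (k / 4 + 2)) (s d) (s d * n ^ s d) ∧
        ComputesWithin Psub A.out (sub H G) (f d * n ^ (k / 4 + 2)) (s d) (s d * n ^ s d) ∧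
        ComputesWithin Pind A.out (ind H G) (f d * n ^ (k / 4 + 2)) (s d) (s d * n ^ s d) := by
  obtain ⟨P₁, f₁, s₁, h₁⟩ := exists_program_constrainedMaps_div (edgeConstraints H) one_pos
    (fun n G => hom H G) fun d n G A => by rw [ncard_constrainedMaps_hom, mul_one]
  obtain ⟨P₂, f₂, s₂, h₂⟩ := exists_program_constrainedMaps_div _ (card_aut_pos H)
    (fun n G => sub H G) fun d n G A => ncard_constrainedMaps_copy H A
  obtain ⟨P₃, f₃, s₃, h₃⟩ := exists_program_constrainedMaps_div _ (card_aut_pos H)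
    (fun n G => ind H G) fun d n G A => ncard_constrainedMaps_embedding H A
  have hword : ∀ {n a b : ℕ}, 1 ≤ n → a ≤ b → a * n ^ a ≤ b * n ^ b := fun hn h =>
    Nat.mul_le_mul h (Nat.pow_le_pow_right hn h)
  refine ⟨fun d => f₁ d + f₂ d + f₃ d, fun d => s₁ d + s₂ d + s₃ d, P₁, P₂, P₃,
    fun d n hn G A => ⟨(h₁ d n hn G A).mono ?_ ?_ (hword hn ?_),
      (h₂ d n hn G A).mono ?_ ?_ (hword hn ?_), (h₃ d n hn G A).mono ?_ ?_ (hword hn ?_)⟩⟩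
  all_goals first | exact Nat.mul_le_mul_right _ (by beta_reduce; omega) | (beta_reduce; omega)

end HostCount

theorem theorem1p4 :
    ∃ f s : ℕ → ℕ → ℕ, ∀ (k : ℕ) (H : SimpleGraph (Fin k)),
      ∃ Phom Psub Pind : HostCount.Program,
        ∀ (d n : ℕ), 1 ≤ n → ∀ (G : SimpleGraph (Fin n)), HostCount.IsDegenerate G d →
          ∀ A : HostCount.Presentation G d,
            HostCount.ComputesWithin Phom A.out (HostCount.hom H G)
              (f k d * n ^ (k / 4 + 2)) (s k d) (s k d * n ^ s k d) ∧
            HostCount.ComputesWithin Psub A.out (HostCount.sub H G)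
              (f k d * n ^ (k / 4 + 2)) (s k d) (s k d * n ^ s k d) ∧
            HostCount.ComputesWithin Pind A.out (HostCount.ind H G)
              (f k d * n ^ (k / 4 + 2)) (s k d) (s k d * n ^ s k d) := by
  classical
  choose f s Phom Psub Pind h using fun (k : ℕ) (H : SimpleGraph (Fin k)) =>
    HostCount.exists_programs H
  have hle : ∀ (g : ∀ k, SimpleGraph (Fin k) → ℕ → ℕ) (k : ℕ) (H : SimpleGraph (Fin k)) (d : ℕ),
      g k H d ≤ ∑ K : SimpleGraph (Fin k), g k K d := fun g k H d =>
    Finset.single_le_sum (f := fun K => g k K d) (fun _ _ => Nat.zero_le _) (Finset.mem_univ H)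
  -- The bounds may depend on `k` but not on `H`; there are finitely many graphs on `Fin k`, so
  -- their bounds are added up.
  refine ⟨fun k d => ∑ H : SimpleGraph (Fin k), f k H d,
    fun k d => ∑ H : SimpleGraph (Fin k), s k H d, fun k H =>
      ⟨Phom k H, Psub k H, Pind k H, fun d n hn G _ A => ?_⟩⟩
  have hf := Nat.mul_le_mul_right (n ^ (k / 4 + 2)) (hle f k H d)
  have hs := hle s k H d
  have hw := Nat.mul_le_mul hs (Nat.pow_le_pow_right hn hs)
  obtain ⟨h₁, h₂, h₃⟩ := h k H d n hn G A
  exact ⟨h₁.mono hf hs hw, h₂.mono hf hs hw, h₃.mono hf hs hw⟩
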